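/- **Adaptively robust single-bit pseudorandom code.** *The scheme $\mathsf{LDPC\text-PRC}_1[n,d,t,r,\eta,\zeta]$.* Let $\mathsf{LDPC}[n,d,t,r]$ be the following distribution of pairs $(H,G)$: $H\in\mathbb F_2^{r\times n}$ has independent uniformly random rows of Hamming weight $t$, and $G\in\mathbb F_2^{n\times d}$ is uniform subject to $HG=0$. - Key generation: sample $(H_0,G_0)$ and $(H_1,G_1)$ independently from $\mathsf{LDPC}[n,d,t,r]$ and $z\in\mathbb F_2^n$ uniformly. The secret key is $(H_0,H_1,z)$ and the public key is $(G_0,G_1,z)$. - Encoding of $m\in\{0,1\}$ with randomness $(u,e)$, which is uniform over $u\in\mathbb F_2^d\setminus\{0\}$ and $e\in\mathbb F_2^n$ of weight $\lfloor\eta n\rfloor$: output $G_mu\oplus z\oplus e$. - Decoding of $x\in\mathbb F_2^n$: output $m\in\{0,1\}$ if $\mathrm{wt}(H_m(x\oplus z))<(\tfrac12-\zeta)r$ (the $H_m$ detector accepts) and $\mathrm{wt}(H_{1-m}(x\oplus z))>(\tfrac12-\zeta)r$ (the $H_{1-m}$ detector rejects); if this holds for neither $m$, output $\bot$. *Adaptive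 $\delta$-robustness.* In the public-key robustness game, keys are generated for the security parameter $\lambda$, and the adversary receives the public key and outputs a bit $m$, encoding randomness $(u,e)$ from the above set, and a string $x\in\mathbb F_2^n$. It wins if $x$ is within Hamming distance $\delta n$ of the encoding of $m$ with randomness $(u,e)$ but $x$ does not decode to $m$. The scheme is adaptively $\delta$-robust if the winning probability of every adversary is negligible in $\lambda$, i.e. smaller than every inverse polynomial in $\lambda$ for large $\lambda$. **Theorem.** Let $\delta<1/4$, and let $n=n(\lambda)$ and $r=r(\lambda)$ be functions of the security parameter with $n\ge\lambda^{\Omega(1)}$ and $n^{\Omega(1)}\le r\le(1-\Omega(1))\,n$. Then there are a rational constant $\eta\in(0,1/2)$ and functions $t=\Theta(\log n)$ and $d=\Omega(\log^2 n)$ such that $\mathsf{LDPC\text-PRC}_1[n,d,t,r,\eta,\tfrac32 r^{-1/5}]$ is adaptively $\delta$-robust, even against computationally unbounded randomized adversaries. Moreover, for all large $\lambda$ one can take $t=2\lfloor\lfloor\log_2 r\rfloor/10\rfloor$ and $d=\lfloor\varepsilon\, t\,\lfloor\log_2 n\rfloor\rfloor$ for a rational constant $\varepsilon>0$, so that $t$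 and $d$ are efficiently computable from $n$ and $r$. -/

import Mathlib

open Filter Asymptotics

noncomputable section

/-- Words of length `n` over the field with two elements. -/
abbrev BinWord (n : ℕ) : Type := Fin n → ZMod 2

/-- The set `S_{t,n}` of words of length `n` and Hamming weight `t`. -/
def sparseVectors (t n : ℕ) : Finset (BinWord n) :=
  Finset.univ.filter fun s => hammingNorm s = t

/-- The set `S_{t,r,n}` of `r × n` matrices all of whose rows have Hamming weight `t`. -/
def rowSparse (t r n : ℕ) : Finset (Matrix (Fin r) (Fin n) (ZMod 2)) :=
  Finset.univ.filter fun H => ∀ i, hammingNorm (H i) = t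

/-- The set `(ker H)^d` of `n × d` matrices `G` with `H G = 0`. -/
def kernelMatrices {r n : ℕ} (H : Matrix (Fin r) (Fin n) (ZMod 2)) (d : ℕ) :
    Finset (Matrix (Fin n) (Fin d) (ZMod 2)) :=
  Finset.univ.filter fun G => H * G = 0

theorem sparseVectors_nonempty {t n : ℕ} (h : t ≤ n) : (sparseVectors t n).Nonempty := by
  refine ⟨fun i => if (i : ℕ) < t then 1 else 0, ?_⟩
  simp only [sparseVectors, Finset.mem_filter, Finset.mem_univ, true_and, hammingNorm]
  have : (Finset.univ.filter fun i : Fin n => (if (i : ℕ) < t then (1 : ZMod 2) else 0) ≠ 0)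
      = Finset.univ.filter fun i : Fin n => (i : ℕ) < t := by
    ext i
    by_cases hi : (i : ℕ) < t <;> simp [hi]
  rw [this, Fin.card_filter_val_lt, min_eq_right h]

theorem rowSparse_nonempty {t n : ℕ} (r : ℕ) (h : t ≤ n) : (rowSparse t r n).Nonempty := by
  obtain ⟨s, hs⟩ := sparseVectors_nonempty h
  simp only [sparseVectors, Finset.mem_filter, Finset.mem_univ, true_and] at hs
  exact ⟨fun _ => s, Finset.mem_filter.mpr ⟨Finset.mem_univ _, fun _ => hs⟩⟩

theorem kernelMatrices_nonempty {r n : ℕ} (H : Matrix (Fin r) (Fin n) (ZMod 2)) (d : ℕ) :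
    (kernelMatrices H d).Nonempty :=
  ⟨0, by simp [kernelMatrices]⟩

theorem nonzero_nonempty {d : ℕ} (h : 0 < d) :
    (Finset.univ.filter fun u : BinWord d => u ≠ 0).Nonempty := by
  refine ⟨fun _ => 1, ?_⟩
  simp only [Finset.mem_filter, Finset.mem_univ, true_and]
  intro hu
  exact one_ne_zero (congrFun hu ⟨0, h⟩)

/-- The distribution `LDPC[n,d,t,r]` of a random parity-check matrix `H` with independent uniform
`t`-sparse rows and a generator matrix `G` that is uniform subject to `H G = 0`. -/
def ldpc (n d t r : ℕ) (ht : t ≤ n) :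
    PMF (Matrix (Fin r) (Fin n) (ZMod 2) × Matrix (Fin n) (Fin d) (ZMod 2)) :=
  (PMF.uniformOfFinset (rowSparse t r n) (rowSparse_nonempty r ht)).bind fun H =>
  (PMF.uniformOfFinset (kernelMatrices H d) (kernelMatrices_nonempty H d)).bind fun G =>
  PMF.pure (H, G)

/-- The data of a public-key code scheme with binary codewords, at one value of the security
parameter: key generation, encoder, and decoder (`none` stands for the symbol `⊥`). The encoder is
given as a function of its explicit randomness, with the distribution from which it samples it. -/
structure CodeScheme where
  /-- the messages -/
  Msg : Type
  /-- the public (encoding) keys -/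
  PK : Type
  /-- the secret (decoding) keys -/
  SK : Type
  /-- the encoder's randomness -/
  Rand : Type
  /-- the codeword length -/
  len : ℕ
  /-- key generation -/
  keyGen : PMF (SK × PK)
  /-- distribution of the encoder's randomness -/
  encRand : PMF Rand
  /-- `encode pk m ρ` is the encoding of `m` with randomness `ρ` -/
  encode : PK → Msg → Rand → BinWord len
  /-- the decoder -/
  decode : SK → BinWord len → Option Msg

namespace CodeScheme

/-- A randomized adversary, of unrestricted computational power, against public-key adaptive
robustness: from the public key it produces a message, encoding randomness, and a word. -/
abbrev Adversary (P : CodeScheme) : Type :=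
  P.PK → PMF (P.Msg × P.Rand × BinWord P.len)

/-- The public-key robustness game: keys are sampled and the adversary is run on the public key.
The outcome is the key pair together with the adversary's answer. -/
def robustGame (P : CodeScheme) (A : P.Adversary) :
    PMF ((P.SK × P.PK) × P.Msg × P.Rand × BinWord P.len) :=
  P.keyGen.bind fun keys => (A keys.2).bind fun out => PMF.pure (keys, out)

/-- The adversary wins with `(m, ρ, x)` if `ρ` is a possible value of the encoder's randomness, `x`
is within Hamming distance `δ n` of the encoding of `m` with randomness `ρ`, and `x` does not decode
to `m`. -/
def Wins (P : CodeScheme) (δ : ℝ) :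
    Set ((P.SK × P.PK) × P.Msg × P.Rand × BinWord P.len) :=
  {ω | match ω with
    | ((sk, pk), m, ρ, x) =>
      ρ ∈ P.encRand.support ∧
      (hammingDist x (P.encode pk m ρ) : ℝ) ≤ δ * P.len ∧
      P.decode sk x ≠ some m}

/-- The probability that the adversary wins the public-key robustness game. -/
def winProb (P : CodeScheme) (δ : ℝ) (A : P.Adversary) : ℝ :=
  ((P.robustGame A).toOuterMeasure (P.Wins δ)).toReal

end CodeScheme

/-- Public-key adaptive `δ`-robustness of a scheme, indexed by the security parameter, against all
adversaries (efficient or not): the winning probability is a negligible function of the security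
parameter. -/
def AdaptivelyRobust (δ : ℝ) (P : ℕ → CodeScheme) : Prop :=
  ∀ A : (k : ℕ) → (P k).Adversary,
    SuperpolynomialDecay atTop (fun k : ℕ => (k : ℝ)) fun k => (P k).winProb δ (A k)

/-- The detector with parity-check matrix `H` accepts the word `y`. -/
def Detects {r n : ℕ} (ζ : ℝ) (H : Matrix (Fin r) (Fin n) (ZMod 2)) (y : BinWord n) : Prop :=
  (hammingNorm (H.mulVec y) : ℝ) < (1 / 2 - ζ) * r

/-- The detector with parity-check matrix `H` rejects the word `y`, strictly. -/
def Rejects {r n : ℕ} (ζ : ℝ) (H : Matrix (Fin r) (Fin n) (ZMod 2)) (y : BinWord n) : Prop :=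
  (hammingNorm (H.mulVec y) : ℝ) > (1 / 2 - ζ) * r

open Classical in
/-- The single-bit public-key pseudorandom LDPC code `LDPC-PRC₁[n,d,t,r,η,ζ]`. The messages `0` and
`1` are `false` and `true`; keys carry one matrix for each message, and the one-time pad `z`. The
weight `η n` of the encoding noise is rounded down. -/
def ldpcPRC1 (n d t r : ℕ) (η ζ : ℝ) (hd : 0 < d) (ht : t ≤ n) (hη : ⌊η * n⌋₊ ≤ n) :
    CodeScheme where
  Msg := Bool
  PK := (Bool → Matrix (Fin n) (Fin d) (ZMod 2)) × BinWord n
  SK := (Bool → Matrix (Fin r) (Fin n) (ZMod 2)) × BinWord n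
  Rand := BinWord d × BinWord n
  len := n
  keyGen :=
    (ldpc n d t r ht).bind fun HG₀ =>
    (ldpc n d t r ht).bind fun HG₁ =>
    (PMF.uniformOfFintype (BinWord n)).bind fun z =>
    PMF.pure ((fun m => if m then HG₁.1 else HG₀.1, z), (fun m => if m then HG₁.2 else HG₀.2, z))
  encRand :=
    (PMF.uniformOfFinset (Finset.univ.filter fun u : BinWord d => u ≠ 0)
      (nonzero_nonempty hd)).bind fun u =>
    (PMF.uniformOfFinset (sparseVectors ⌊η * n⌋₊ n) (sparseVectors_nonempty hη)).bind fun e =>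
    PMF.pure (u, e)
  encode := fun pk m ρ => (pk.1 m).mulVec ρ.1 + pk.2 + ρ.2
  decode := fun sk x =>
    if Detects ζ (sk.1 false) (x + sk.2) ∧ Rejects ζ (sk.1 true) (x + sk.2) then some false
    else if Detects ζ (sk.1 true) (x + sk.2) ∧ Rejects ζ (sk.1 false) (x + sk.2) then some true
    else none

theorem floor_mul_le_of_le_one {η : ℝ} (h : η ≤ 1) (n : ℕ) : ⌊η * n⌋₊ ≤ n :=
  Nat.floor_le_of_le (mul_le_of_le_one_left (Nat.cast_nonneg n) h)

end

/-! For a fixed public matrix `G` the rows of the secret `H` behave, up to a bounded factor, like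
independent uniform words of weight `t` orthogonal to the columns of `G`. The adversary's answer
depends on the public key alone, so it is enough to bound, for each public key and each fixed
answer, the mass of the secret matrices that make decoding fail. No union over answers is needed,
and computational power plays no role.

Poisson summation expresses the exponential moment of one row at a word `y` through sums over `v` of
`kraw t (G v + y)` (`sum_sparseDual_exp`), and `kraw t` is close to the `t`-th power of the bias
(`abs_kraw_sub_pow_le`). If all nonzero combinations of columns have small bias, their sign vectors
are nearly orthogonal. Hence the squares of the non-negligible biases of `G v + y` sum to at most 2
(`sum_sq_bias_le`), and their `t`-th powers to at most `2 M ^ (t - 2)` when `M` bounds these biases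
(`sum_abs_kraw_le`).

An admissible answer is, after removing `z`, a codeword `G_m u` plus noise of relative weight at
most `β = 1/4 - γ`. For `H_m`, the summand `v = u` contributes nearly `(1 - 2β)^t = (1/2 + 2γ)^t` or
more, while all others have bias at most about `2β = 1/2 - 2γ`; for `H_{1-m}` only summands of the
latter kind occur. So a threshold of order `2^(-t)` separates the two cases once `t` is large, which
is where `δ < 1/4` enters. The choice of `t` makes `2^(-t)` comparable to `x = r^(-1/5)`, and a
Chernoff bound over the `r` rows gives failure `exp (-r x²) = exp (-r^(3/5))`.

It remains to exclude bad public keys. For `u ≠ 0`, `G u` is uniform on the kernel of `H`, so `G u =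
y` has probability at most `2^(-n) (1 + kraw t y)^r`. Summed over biased `y` this is small: by
Hoeffding for moderate bias, and by `r ≤ κ n` for bias near 1 (`sum_biased_one_add_kraw_le`).
Moreover a low-bias `G` has at most twice the uniform mass (`Reliable.sum_ldpc_le`), so the cross
biases of `G₀` and `G₁` can be handled as for uniform matrices. -/

noncomputable section

/-! ### Signs and biases of binary words. -/

/-- The nontrivial character of the field with two elements, with real values. -/
def sgn (a : ZMod 2) : ℝ := if a = 0 then 1 else -1

@[simp] theorem sgn_zero : sgn 0 = 1 := by simp [sgn]

theorem sgn_add (a b : ZMod 2) : sgn (a + b) = sgn a * sgn b := by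
  have h : ∀ a b : ZMod 2, (a + b = 0 ↔ (a = 0 ↔ b = 0)) := by decide
  unfold sgn
  have := h a b
  by_cases ha : a = 0 <;> by_cases hb : b = 0 <;> simp_all

theorem sgn_mul_self (a : ZMod 2) : sgn a * sgn a = 1 := by
  unfold sgn; split_ifs <;> norm_num

theorem abs_sgn (a : ZMod 2) : |sgn a| = 1 := by
  unfold sgn; split_ifs <;> norm_num

theorem sgn_sum {ι : Type*} (s : Finset ι) (f : ι → ZMod 2) :
    sgn (∑ i ∈ s, f i) = ∏ i ∈ s, sgn (f i) := by
  classical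
  induction s using Finset.induction_on with
  | empty => simp
  | insert a s ha ih => rw [Finset.sum_insert ha, Finset.prod_insert ha, sgn_add, ih]

/-- The sum of the signs of the letters of a word. -/
def signSum {n : ℕ} (y : BinWord n) : ℝ := ∑ i, sgn (y i)

theorem signSum_eq {n : ℕ} (y : BinWord n) : signSum y = n - 2 * hammingNorm y := by
  have : ∀ i, sgn (y i) = 1 - 2 * (if y i ≠ 0 then 1 else 0) := by
    intro i; by_cases h : y i = 0 <;> simp [sgn, h]; norm_num
  simp only [signSum, this, Finset.sum_sub_distrib, ← Finset.mul_sum, Finset.sum_boole]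
  simp [hammingNorm]

/-- The normalized sum of signs of a word. -/
def bias {n : ℕ} (y : BinWord n) : ℝ := signSum y / n

theorem abs_signSum_le {n : ℕ} (y : BinWord n) : |signSum y| ≤ n := by
  refine (Finset.abs_sum_le_sum_abs _ _).trans ?_
  simp [abs_sgn]

theorem abs_bias_le_one {n : ℕ} (y : BinWord n) : |bias y| ≤ 1 := by
  rw [bias, abs_div, Nat.abs_cast]
  exact div_le_one_of_le₀ (abs_signSum_le y) (Nat.cast_nonneg n)

theorem abs_bias_add_sub_le {n : ℕ} (y w : BinWord n) :
    |bias (y + w) - bias y| ≤ 2 * hammingNorm w / n := by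
  rw [bias, bias, ← sub_div, abs_div, Nat.abs_cast]
  gcongr
  have h1 : signSum (y + w) - signSum y = ∑ i, sgn (y i) * (sgn (w i) - 1) := by
    rw [signSum, signSum, ← Finset.sum_sub_distrib]
    exact Finset.sum_congr rfl fun i _ => by rw [Pi.add_apply, sgn_add]; ring
  rw [h1]
  refine (Finset.abs_sum_le_sum_abs _ _).trans ?_
  have h2 : ∀ i, |sgn (y i) * (sgn (w i) - 1)| = 1 - sgn (w i) := by
    intro i
    rw [abs_mul, abs_sgn, one_mul]
    unfold sgn; split_ifs <;> norm_num
  simp only [h2]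
  have := signSum_eq w
  rw [signSum] at this
  rw [Finset.sum_sub_distrib, this]
  simp

/-! ### Krawtchouk polynomials: recursion and comparison with powers of the bias. -/

/-- The average of the signs `(-1)^{s · y}` over the words `s` of weight `t`: a normalized
Krawtchouk polynomial. -/
def kraw {n : ℕ} (t : ℕ) (y : BinWord n) : ℝ :=
  (∑ s ∈ sparseVectors t n, sgn (s ⬝ᵥ y)) / (sparseVectors t n).card

-- Choosing `1` or the linear term in each factor records the support of `s`, so the product is the
-- generating function in `t` of the unnormalized Krawtchouk values.
open Polynomial in
theorem coeff_prod_one_add {n : ℕ} (t : ℕ) (y : BinWord n) :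
    (∏ i, (1 + C (sgn (y i)) * X : ℝ[X])).coeff t
      = ∑ s ∈ sparseVectors t n, sgn (s ⬝ᵥ y) := by
  have h1 : ∀ i, (1 + C (sgn (y i)) * X : ℝ[X])
      = ∑ a : ZMod 2, C (sgn (a * y i)) * X ^ (if a ≠ 0 then 1 else 0) := by
    intro i
    rw [show (Finset.univ : Finset (ZMod 2)) = {0, 1} from rfl, Finset.sum_pair zero_ne_one]
    simp
  simp only [h1]
  rw [Finset.prod_univ_sum, Polynomial.finsetSum_coeff, sparseVectors, Finset.sum_filter]
  rw [Fintype.piFinset_univ]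
  refine Finset.sum_congr rfl fun s _ => ?_
  rw [Finset.prod_mul_distrib, ← map_prod, Finset.prod_pow_eq_pow_sum, ← sgn_sum,
    Polynomial.coeff_C_mul, Polynomial.coeff_X_pow]
  have : (∑ i, if s i ≠ 0 then 1 else 0) = hammingNorm s := by
    rw [hammingNorm, Finset.card_filter]
  rw [this]
  by_cases h : hammingNorm s = t
  · simp [h, dotProduct]
  · simp [h, Ne.symm h]

open Polynomial in
theorem card_sparseVectors (t n : ℕ) : (sparseVectors t n).card = n.choose t := by
  have h := coeff_prod_one_add t (0 : BinWord n)
  simp only [Pi.zero_apply, sgn_zero, map_one, one_mul, Finset.prod_const, dotProduct_zero,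
    Finset.sum_const, Finset.card_univ, Fintype.card_fin, coeff_one_add_X_pow] at h
  simpa using h.symm

-- Since `x² = 1`, the logarithmic derivative of `1 + x X` is `(x - X) / (1 - X²)`. The common
-- denominator gives a first-order differential equation, whose coefficients are a three-term
-- recursion.
open Polynomial in
theorem prod_one_add_derivative {ι : Type*} (s : Finset ι) (x : ι → ℝ)
    (hx : ∀ i, x i * x i = 1) :
    (1 - X ^ 2) * derivative (∏ i ∈ s, (1 + C (x i) * X : ℝ[X]))
      = (C (∑ i ∈ s, x i) - C (s.card : ℝ) * X) * ∏ i ∈ s, (1 + C (x i) * X : ℝ[X]) := by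
  classical
  induction s using Finset.induction_on with
  | empty => simp
  | insert a s ha ih =>
    rw [Finset.prod_insert ha, derivative_mul, Finset.sum_insert ha, Finset.card_insert_of_notMem ha]
    have hc : (C (x a) * C (x a) : ℝ[X]) = 1 := by rw [← C_mul, hx, C_1]
    have hd : derivative (1 + C (x a) * X : ℝ[X]) = C (x a) := by simp
    rw [hd]
    push_cast
    simp only [C_add, C_1]
    linear_combination (1 + C (x a) * X) * ih
      - (X * ∏ i ∈ s, (1 + C (x i) * X : ℝ[X])) * hc

theorem sum_sgn_recursion {n : ℕ} (t : ℕ) (y : BinWord n) :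
    ((t : ℝ) + 2) * ∑ s ∈ sparseVectors (t + 2) n, sgn (s ⬝ᵥ y)
      = signSum y * (∑ s ∈ sparseVectors (t + 1) n, sgn (s ⬝ᵥ y))
        - (n - t) * ∑ s ∈ sparseVectors t n, sgn (s ⬝ᵥ y) := by
  open Polynomial in
  have h := prod_one_add_derivative Finset.univ (fun i => sgn (y i)) (fun i => sgn_mul_self _)
  have h2 := congrArg (fun p => Polynomial.coeff p (t + 1)) h
  simp only [sub_mul, one_mul, mul_assoc, Polynomial.coeff_sub, Polynomial.coeff_C_mul,
    Polynomial.coeff_X_mul] at h2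
  rw [← coeff_prod_one_add, ← coeff_prod_one_add, ← coeff_prod_one_add]
  generalize (∏ i, (1 + Polynomial.C (sgn (y i)) * Polynomial.X : Polynomial ℝ)) = P at *
  rw [Polynomial.coeff_derivative] at h2
  have h3 : (Polynomial.X ^ 2 * Polynomial.derivative P).coeff (t + 1) = t * P.coeff t := by
    cases t with
    | zero => rw [Polynomial.coeff_X_pow_mul']; simp
    | succ t => rw [show t + 1 + 1 = t + 2 from rfl, Polynomial.coeff_X_pow_mul,
        Polynomial.coeff_derivative]; push_cast; ring
  rw [h3] at h2
  simp only [signSum, Finset.card_univ, Fintype.card_fin] at *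
  push_cast at h2
  linear_combination h2

theorem sum_sgn_one {n : ℕ} (y : BinWord n) :
    ∑ s ∈ sparseVectors 1 n, sgn (s ⬝ᵥ y) = signSum y := by
  have h := prod_one_add_derivative Finset.univ (fun i => sgn (y i)) (fun i => sgn_mul_self _)
  have h2 := congrArg (fun p => Polynomial.coeff p 0) h
  rw [← coeff_prod_one_add]
  have h0 : (∏ i, (1 + Polynomial.C (sgn (y i)) * Polynomial.X : Polynomial ℝ)).coeff 0 = 1 := by
    simp [Polynomial.coeff_zero_prod]
  simp only [Polynomial.mul_coeff_zero, h0, Polynomial.coeff_derivative] at h2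
  simpa [signSum] using h2

theorem kraw_zero {n : ℕ} (y : BinWord n) : kraw 0 y = 1 := by
  have : sparseVectors 0 n = {0} := by ext s; simp [sparseVectors]
  simp [kraw, this]

theorem kraw_one {n : ℕ} (y : BinWord n) : kraw 1 y = bias y := by
  rw [kraw, sum_sgn_one, card_sparseVectors, bias, Nat.choose_one_right]

/-- For `t` small against `n` this reads `kraw (t + 2) ≈ bias * kraw (t + 1)`, which is the source
of both estimates below. -/
theorem kraw_recursion {n t : ℕ} (ht : t + 2 ≤ n) (y : BinWord n) :
    (n - (t + 1)) * kraw (t + 2) y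
      = n * bias y * kraw (t + 1) y - (t + 1) * kraw t y := by
  have h := sum_sgn_recursion t y
  have hn : (0 : ℝ) < n := by exact_mod_cast (by omega : 0 < n)
  have c0 : (0 : ℝ) < n.choose t := by exact_mod_cast Nat.choose_pos (by omega)
  have c1 : (0 : ℝ) < n.choose (t + 1) := by exact_mod_cast Nat.choose_pos (by omega)
  have c2 : (0 : ℝ) < n.choose (t + 2) := by exact_mod_cast Nat.choose_pos (by omega)
  have e1 : (n.choose (t + 1) : ℝ) * (t + 1) = n.choose t * (n - t) := by
    have := Nat.choose_succ_right_eq n t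
    have h2 : ((n - t : ℕ) : ℝ) = n - t := by rw [Nat.cast_sub (by omega)]
    rw [← h2]; exact_mod_cast this
  have e2 : (n.choose (t + 2) : ℝ) * (t + 2) = n.choose (t + 1) * (n - (t + 1)) := by
    have := Nat.choose_succ_right_eq n (t + 1)
    have h2 : ((n - (t + 1) : ℕ) : ℝ) = n - (t + 1) := by rw [Nat.cast_sub (by omega)]; push_cast; ring
    rw [← h2]; exact_mod_cast this
  have hb : (n : ℝ) * bias y = signSum y := by rw [bias]; field_simp
  simp only [kraw, card_sparseVectors, hb]
  generalize ∑ s ∈ sparseVectors (t + 2) n, sgn (s ⬝ᵥ y) = E2 at *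
  generalize ∑ s ∈ sparseVectors (t + 1) n, sgn (s ⬝ᵥ y) = E1 at *
  generalize ∑ s ∈ sparseVectors t n, sgn (s ⬝ᵥ y) = E0 at *
  have hE2 : (n - (t + 1) : ℝ) * (E2 / n.choose (t + 2)) = (t + 2) * E2 / n.choose (t + 1) := by
    field_simp
    linear_combination (-E2) * e2
  have hE0 : (t + 1 : ℝ) * (E0 / n.choose t) = (n - t) * E0 / n.choose (t + 1) := by
    field_simp
    linear_combination (E0) * e1
  rw [hE2, hE0, h]
  ring

theorem abs_kraw_le_one {n : ℕ} (t : ℕ) (y : BinWord n) : |kraw t y| ≤ 1 := by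
  rw [kraw, abs_div, Nat.abs_cast]
  refine div_le_one_of_le₀ ((Finset.abs_sum_le_sum_abs _ _).trans ?_) (Nat.cast_nonneg _)
  simp [abs_sgn]

/-- Meant for words of small bias, of which there may be `2 ^ d`: an additive error of order `t² /
n` would be too large there. Each of the two terms of the recursion contributes at most `(n / 4) ρ ^
(j + 2)`, against a leading coefficient of at least `n / 2`. -/
theorem abs_kraw_le_pow {n t : ℕ} (ht : 2 * t ≤ n) (y : BinWord n) {ρ : ℝ}
    (hρ : 4 * |bias y| ≤ ρ) (hρ' : 4 * (t : ℝ) ≤ n * ρ ^ 2) :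
    ∀ j ≤ t, |kraw j y| ≤ ρ ^ j := by
  have hρ0 : 0 ≤ ρ := le_trans (by positivity) hρ
  intro j
  induction j using Nat.twoStepInduction with
  | zero => intro _; simp [kraw_zero]
  | one => intro _; rw [kraw_one, pow_one]; linarith [abs_nonneg (bias y)]
  | more j ih0 ih1 =>
    intro hj
    have h0 := ih0 (by omega)
    have h1 := ih1 (by omega)
    have hr := kraw_recursion (by omega : j + 2 ≤ n) y
    have hn : (n : ℝ) / 2 ≤ n - (j + 1) := by
      have : 2 * (j + 2 : ℝ) ≤ n := by exact_mod_cast (by omega : 2 * (j + 2) ≤ n)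
      linarith
    have hn0 : (0 : ℝ) < n := by exact_mod_cast (by omega : 0 < n)
    have hjt : (j : ℝ) + 1 ≤ t := by exact_mod_cast (by omega : j + 1 ≤ t)
    have key : (n - (j + 1)) * |kraw (j + 2) y| ≤ (n - (j + 1)) * ρ ^ (j + 2) := by
      rw [← abs_of_pos (by linarith : (0 : ℝ) < n - (j + 1)), ← abs_mul, hr,
        abs_of_pos (by linarith : (0 : ℝ) < n - (j + 1))]
      calc |n * bias y * kraw (j + 1) y - (j + 1) * kraw j y|
          ≤ |n * bias y * kraw (j + 1) y| + |(j + 1) * kraw j y| := abs_sub _ _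
        _ = n * |bias y| * |kraw (j + 1) y| + (j + 1) * |kraw j y| := by
          rw [abs_mul, abs_mul, abs_mul, abs_of_pos hn0, abs_of_pos (by positivity : (0:ℝ) < j + 1)]
        _ ≤ n * (ρ / 4) * ρ ^ (j + 1) + (n * ρ ^ 2 / 4) * ρ ^ j := by
          gcongr
          · linarith
          · linarith
        _ = n / 2 * ρ ^ (j + 2) := by ring
        _ ≤ _ := by gcongr
    exact le_of_mul_le_mul_left key (by linarith)

/-- Each step of the recursion differs from multiplication by the bias by at most `4 (j + 1) / n`,
and a bias of modulus at most 1 does not amplify earlier errors. -/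
theorem abs_kraw_sub_pow_le {n t : ℕ} (ht : 2 * t ≤ n) (y : BinWord n) :
    |kraw t y - bias y ^ t| ≤ 2 * (t : ℝ) ^ 2 / n := by
  have hb := abs_bias_le_one y
  have main : ∀ j ≤ t, |kraw j y - bias y ^ j| ≤ 2 * (j : ℝ) ^ 2 / n := by
    intro j
    induction j with
    | zero => intro _; simp [kraw_zero]
    | succ j ih =>
      intro hj
      have h1 := ih (by omega)
      cases j with
      | zero => simp [kraw_one]; positivity
      | succ j =>
        have hr := kraw_recursion (by omega : j + 2 ≤ n) y
        have hn0 : (0 : ℝ) < n := by exact_mod_cast (by omega : 0 < n)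
        have hn : (n : ℝ) / 2 ≤ n - (j + 1) := by
          have : 2 * (j + 2 : ℝ) ≤ n := by exact_mod_cast (by omega : 2 * (j + 2) ≤ n)
          linarith
        have hd : |kraw (j + 2) y - bias y * kraw (j + 1) y| ≤ 4 * (j + 1) / n := by
          rw [le_div_iff₀ hn0]
          have hk0 := abs_kraw_le_one j y
          have hk1 := abs_kraw_le_one (j + 1) y
          have e : (n - (j + 1)) * (kraw (j + 2) y - bias y * kraw (j + 1) y)
              = (j + 1) * (bias y * kraw (j + 1) y - kraw j y) := by
            linear_combination hr
          have e2 : (n - (j + 1)) * |kraw (j + 2) y - bias y * kraw (j + 1) y|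
              = (j + 1) * |bias y * kraw (j + 1) y - kraw j y| := by
            rw [← abs_of_pos (by linarith : (0 : ℝ) < n - (j + 1)), ← abs_mul, e, abs_mul,
              abs_of_pos (by positivity : (0:ℝ) < j + 1)]
          have e3 : |bias y * kraw (j + 1) y - kraw j y| ≤ 2 := by
            refine (abs_sub _ _).trans ?_
            rw [abs_mul]
            nlinarith [abs_nonneg (bias y), abs_nonneg (kraw (j + 1) y)]
          have e4 : (n : ℝ) / 2 * |kraw (j + 2) y - bias y * kraw (j + 1) y|
              ≤ (j + 1) * 2 := by
            calc _ ≤ (n - (j + 1)) * |kraw (j + 2) y - bias y * kraw (j + 1) y| := by gcongr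
              _ ≤ _ := by rw [e2]; gcongr
          linarith
        have e : kraw (j + 2) y - bias y ^ (j + 2) = (kraw (j + 2) y - bias y * kraw (j + 1) y)
            + bias y * (kraw (j + 1) y - bias y ^ (j + 1)) := by ring
        rw [show j + 1 + 1 = j + 2 from rfl, e]
        refine (abs_add_le _ _).trans ?_
        rw [abs_mul]
        have e5 : |bias y| * |kraw (j + 1) y - bias y ^ (j + 1)|
            ≤ 1 * (2 * ((j + 1 : ℕ) : ℝ) ^ 2 / n) := by gcongr
        refine (add_le_add hd e5).trans ?_
        rw [one_mul, ← add_div]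
        gcongr
        push_cast
        nlinarith
  exact main t le_rfl

/-! ### Near-orthogonality of low-bias codes. -/

/-- All nontrivial combinations of the columns of `G` have bias at most `μ`. -/
def LowBias {n d : ℕ} (μ : ℝ) (G : Matrix (Fin n) (Fin d) (ZMod 2)) : Prop :=
  ∀ u : BinWord d, u ≠ 0 → |bias (G.mulVec u)| ≤ μ

theorem sum_sgn_mul_sgn {n : ℕ} (a b : BinWord n) :
    ∑ i, sgn (a i) * sgn (b i) = n * bias (a + b) := by
  rcases Nat.eq_zero_or_pos n with rfl | hn
  · simp
  · have : (n : ℝ) ≠ 0 := by positivity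
    rw [bias, mul_div_cancel₀ _ this, signSum]
    exact Finset.sum_congr rfl fun i _ => by rw [Pi.add_apply, sgn_add]

theorem BinWord.add_self {n : ℕ} (a : BinWord n) : a + a = 0 :=
  funext fun _ => CharTwo.add_self_eq_zero _

theorem BinWord.add_eq_zero {n : ℕ} {a b : BinWord n} (h : a + b = 0) : a = b := by
  have := congrArg (· + b) h
  simpa [add_assoc, BinWord.add_self] using this

/-- A Bessel inequality: the sign vectors of the words `G v` have normalized inner products at most
`μ` in modulus, and `bias (G v + y)` is the coefficient of the sign vector of `y` along them.
Cauchy–Schwarz is applied to `y` and the combination of these vectors with those same coefficients.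
-/
theorem sum_sq_bias_le {n d : ℕ} (hn : 0 < n) {μ : ℝ} (hμ : 0 ≤ μ)
    {G : Matrix (Fin n) (Fin d) (ZMod 2)} (hG : LowBias μ G) (y : BinWord n)
    (V : Finset (BinWord d)) :
    ∑ v ∈ V, bias (G.mulVec v + y) ^ 2 ≤ 1 + μ * V.card := by
  set c : BinWord d → ℝ := fun v => bias (G.mulVec v + y) with hc
  set S := ∑ v ∈ V, c v ^ 2 with hS
  have hn0 : (0 : ℝ) < n := by exact_mod_cast hn
  have hS0 : 0 ≤ S := Finset.sum_nonneg fun _ _ => sq_nonneg _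
  have e1 : n * S = ∑ i, sgn (y i) * ∑ v ∈ V, c v * sgn (G.mulVec v i) := by
    simp only [Finset.mul_sum]
    rw [Finset.sum_comm, hS, Finset.mul_sum]
    refine Finset.sum_congr rfl fun v _ => ?_
    have := sum_sgn_mul_sgn (G.mulVec v) y
    calc n * c v ^ 2 = c v * (n * bias (G.mulVec v + y)) := by simp only [hc]; ring
      _ = _ := by
        rw [← this, Finset.mul_sum]
        exact Finset.sum_congr rfl fun i _ => by ring
  have e2 : ∑ i, (∑ v ∈ V, c v * sgn (G.mulVec v i)) ^ 2
      = n * ∑ v ∈ V, ∑ w ∈ V, c v * c w * bias (G.mulVec (v + w)) := by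
    simp only [sq, Finset.sum_mul_sum]
    rw [Finset.sum_comm, Finset.mul_sum]
    refine Finset.sum_congr rfl fun v _ => ?_
    rw [Finset.sum_comm, Finset.mul_sum]
    refine Finset.sum_congr rfl fun w _ => ?_
    rw [Matrix.mulVec_add, mul_left_comm, ← sum_sgn_mul_sgn, Finset.mul_sum]
    exact Finset.sum_congr rfl fun i _ => by ring
  -- Gram matrix estimate: diagonal entries are at most 1, off-diagonal ones at most `μ`.
  have e3 : ∑ v ∈ V, ∑ w ∈ V, c v * c w * bias (G.mulVec (v + w))
      ≤ S + μ * (∑ v ∈ V, |c v|) ^ 2 := by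
    have : ∀ v ∈ V, ∀ w ∈ V, c v * c w * bias (G.mulVec (v + w))
        ≤ (if v = w then c v ^ 2 else 0) + μ * (|c v| * |c w|) := by
      intro v _ w _
      split_ifs with h
      · subst h
        have h1 : bias (G.mulVec (v + v)) ≤ 1 := (le_abs_self _).trans (abs_bias_le_one _)
        have h2 : 0 ≤ μ * (|c v| * |c v|) := by positivity
        nlinarith [sq_nonneg (c v)]
      · have h1 := hG (v + w) (fun h' => h (BinWord.add_eq_zero h'))
        rw [zero_add]
        refine (le_abs_self _).trans ?_
        rw [abs_mul, abs_mul, mul_comm]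
        gcongr
    refine (Finset.sum_le_sum fun v hv => Finset.sum_le_sum fun w hw => this v hv w hw).trans ?_
    simp only [Finset.sum_add_distrib]
    rw [sq, Finset.sum_mul_sum, Finset.mul_sum]
    simp only [Finset.mul_sum]
    gcongr
    rw [hS]
    refine Finset.sum_le_sum fun v hv => ?_
    rw [Finset.sum_ite_eq, if_pos hv]
  have e4 : (∑ v ∈ V, |c v|) ^ 2 ≤ V.card * S := by
    have := sq_sum_le_card_mul_sum_sq (s := V) (f := fun v => |c v|)
    simpa [sq_abs] using this
  have cs := Finset.sum_mul_sq_le_sq_mul_sq Finset.univ (fun i => sgn (y i))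
    (fun i => ∑ v ∈ V, c v * sgn (G.mulVec v i))
  have e5 : ∑ i, sgn (y i) ^ 2 = n := by simp [sq, sgn_mul_self]
  rw [← e1, e2, e5] at cs
  have e6 : S ^ 2 ≤ (1 + μ * V.card) * S := by
    have : (n : ℝ) ^ 2 * S ^ 2 ≤ n ^ 2 * ((1 + μ * V.card) * S) := by
      calc (n : ℝ) ^ 2 * S ^ 2 = (n * S) ^ 2 := by ring
        _ ≤ _ := cs
        _ ≤ n * (n * (S + μ * (V.card * S))) := by
          gcongr
          refine e3.trans ?_
          gcongr
        _ = _ := by ring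
    exact le_of_mul_le_mul_left this (by positivity)
  rcases hS0.eq_or_lt with h | h
  · rw [← h]; positivity
  · rw [sq] at e6
    exact le_of_mul_le_mul_right e6 h

/-- The sum is split at bias `α`. Above it, near-orthogonality leaves at most `2 / α ^ 2` words with
squared biases summing to at most 2, so the additive approximation by powers is affordable. Below
it, the geometric bound beats the trivial count `2 ^ d`. -/
theorem sum_abs_kraw_le {n d t : ℕ} (hn : 0 < n) (ht2 : 2 ≤ t) (ht : 2 * t ≤ n) {α M : ℝ}
    (hα : 0 < α) (hα' : (t : ℝ) ≤ n * α ^ 2) (hM : 0 ≤ M)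
    {G : Matrix (Fin n) (Fin d) (ZMod 2)} (hG : LowBias (α ^ 2 / 2) G) (y : BinWord n)
    (V : Finset (BinWord d)) (hV : ∀ v ∈ V, |bias (G.mulVec v + y)| ≤ M) :
    ∑ v ∈ V, |kraw t (G.mulVec v + y)|
      ≤ 2 * M ^ (t - 2) + 2 / α ^ 2 * (2 * (t : ℝ) ^ 2 / n) + 2 ^ d * (4 * α) ^ t := by
  set c : BinWord d → ℝ := fun v => bias (G.mulVec v + y) with hc
  rw [← Finset.sum_filter_add_sum_filter_not V (fun v => α ≤ |c v|)]
  set L := V.filter (fun v => α ≤ |c v|) with hL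
  have hS := sum_sq_bias_le hn (by positivity) hG y L
  have hLS : L.card * α ^ 2 ≤ ∑ v ∈ L, bias (G.mulVec v + y) ^ 2 := by
    rw [← nsmul_eq_mul, ← Finset.sum_const]
    refine Finset.sum_le_sum fun v hv => ?_
    rw [← sq_abs (bias _)]
    have := (Finset.mem_filter.mp hv).2
    gcongr
  -- With `μ = α ^ 2 / 2`, the bound `|L| α² ≤ 1 + μ |L|` absorbs half of its left side.
  have hcard : (L.card : ℝ) ≤ 2 / α ^ 2 := by
    rw [le_div_iff₀ (by positivity)]; linarith
  have hS2 : ∑ v ∈ L, bias (G.mulVec v + y) ^ 2 ≤ 2 := by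
    rw [le_div_iff₀ (by positivity)] at hcard; linarith
  have big : ∑ v ∈ L, |kraw t (G.mulVec v + y)|
      ≤ 2 * M ^ (t - 2) + 2 / α ^ 2 * (2 * (t : ℝ) ^ 2 / n) := by
    calc ∑ v ∈ L, |kraw t (G.mulVec v + y)|
        ≤ ∑ v ∈ L, (bias (G.mulVec v + y) ^ 2 * M ^ (t - 2) + 2 * (t : ℝ) ^ 2 / n) := by
          refine Finset.sum_le_sum fun v hv => ?_
          have h1 := abs_kraw_sub_pow_le ht (G.mulVec v + y)
          have h2 := abs_sub_abs_le_abs_sub (kraw t (G.mulVec v + y)) (bias (G.mulVec v + y) ^ t)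
          have h3 : |bias (G.mulVec v + y) ^ t| ≤ bias (G.mulVec v + y) ^ 2 * M ^ (t - 2) := by
            have : t = 2 + (t - 2) := by omega
            rw [abs_pow]
            nth_rw 1 [this]
            rw [pow_add, sq_abs]
            have := hV v (Finset.mem_filter.mp hv).1
            gcongr
          linarith
      _ = (∑ v ∈ L, bias (G.mulVec v + y) ^ 2) * M ^ (t - 2) + L.card * (2 * (t : ℝ) ^ 2 / n) := by
          rw [Finset.sum_add_distrib, Finset.sum_mul, Finset.sum_const, nsmul_eq_mul]
      _ ≤ _ := by gcongr
  have small : ∑ v ∈ V.filter (fun v => ¬ α ≤ |c v|), |kraw t (G.mulVec v + y)|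
      ≤ 2 ^ d * (4 * α) ^ t := by
    refine (Finset.sum_le_card_nsmul _ _ ((4 * α) ^ t) fun v hv => ?_).trans ?_
    · have := (Finset.mem_filter.mp hv).2
      refine abs_kraw_le_pow ht _ ?_ ?_ t le_rfl
      · simp only [hc] at this; linarith
      · nlinarith
    · rw [nsmul_eq_mul]
      gcongr
      refine (Nat.cast_le.mpr (Finset.card_le_univ _)).trans ?_
      simp [ZMod.card]
  linarith

theorem LowBias.sum_abs_kraw_le {n d t : ℕ} (ht : 2 * t ≤ n) {α : ℝ}
    (hα : 0 < α) (hα1 : α ≤ 1) (hα' : (t : ℝ) ≤ n * α ^ 2)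
    {G : Matrix (Fin n) (Fin d) (ZMod 2)} (hG : LowBias (α ^ 2 / 2) G) :
    ∑ v ∈ Finset.univ.erase 0, |kraw t (G.mulVec v)| ≤ 2 ^ d * (4 * α) ^ t := by
  refine (Finset.sum_le_card_nsmul _ _ ((4 * α) ^ t) fun v hv => ?_).trans ?_
  · have := hG v (Finset.ne_of_mem_erase hv)
    refine abs_kraw_le_pow ht _ ?_ ?_ t le_rfl
    · nlinarith
    · nlinarith
  · rw [nsmul_eq_mul]
    gcongr
    refine (Nat.cast_le.mpr (Finset.card_le_univ _)).trans ?_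
    simp [ZMod.card]

/-! ### Poisson summation over sparse dual words. -/

/-- The indicator of `z = 0` as an average of characters. -/
theorem sum_sgn_dotProduct {d : ℕ} (z : BinWord d) :
    ∑ v : BinWord d, sgn (z ⬝ᵥ v) = if z = 0 then 2 ^ d else 0 := by
  have h : ∀ v : BinWord d, sgn (z ⬝ᵥ v) = ∏ i, sgn (z i * v i) := fun v => by
    rw [dotProduct, sgn_sum]
  simp only [h]
  rw [← Fintype.prod_sum (fun i (a : ZMod 2) => sgn (z i * a))]
  have h2 : ∀ i, ∑ a : ZMod 2, sgn (z i * a) = if z i = 0 then 2 else 0 := by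
    intro i
    rw [show (Finset.univ : Finset (ZMod 2)) = {0, 1} from rfl, Finset.sum_pair zero_ne_one]
    by_cases hz : z i = 0 <;> simp [hz, sgn]
    norm_num
  simp only [h2]
  split_ifs with hz
  · subst hz; simp
  · obtain ⟨i, hi⟩ := Function.ne_iff.mp hz
    exact Finset.prod_eq_zero (Finset.mem_univ i) (if_neg hi)

/-- Words of weight `t` orthogonal to the columns of `G`. -/
def sparseDual {n d : ℕ} (t : ℕ) (G : Matrix (Fin n) (Fin d) (ZMod 2)) : Finset (BinWord n) :=
  (sparseVectors t n).filter fun s => Matrix.vecMul s G = 0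

/-- The average over `v` of the sign of `s · G v` is the indicator of `s G = 0`; exchanging the sums
over `s` and `v` produces the Krawtchouk values. -/
theorem sum_sparseDual_sgn {n d : ℕ} (t : ℕ) (G : Matrix (Fin n) (Fin d) (ZMod 2))
    (ht : t ≤ n) (y : BinWord n) :
    2 ^ d * ∑ s ∈ sparseDual t G, sgn (s ⬝ᵥ y)
      = (sparseVectors t n).card * ∑ v, kraw t (G.mulVec v + y) := by
  have hc : ((sparseVectors t n).card : ℝ) ≠ 0 := by
    exact_mod_cast (sparseVectors_nonempty ht).card_ne_zero
  simp only [kraw]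
  rw [← Finset.sum_div, mul_div_cancel₀ _ hc, Finset.sum_comm, sparseDual, Finset.sum_filter,
    Finset.mul_sum]
  refine Finset.sum_congr rfl fun s _ => ?_
  simp only [dotProduct_add, sgn_add, Matrix.dotProduct_mulVec]
  rw [← Finset.sum_mul, sum_sgn_dotProduct]
  split_ifs <;> simp

/-- A sign `σ` satisfies `exp (l σ) = cosh l + σ sinh l`, so an exponential moment needs only the
character sums at `0` and at `y`. -/
theorem sum_sparseDual_exp {n d : ℕ} (t : ℕ) (G : Matrix (Fin n) (Fin d) (ZMod 2))
    (ht : t ≤ n) (y : BinWord n) (l : ℝ) :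
    2 ^ d * ∑ s ∈ sparseDual t G, Real.exp (l * sgn (s ⬝ᵥ y))
      = (sparseVectors t n).card * ((∑ v, kraw t (G.mulVec v)) * Real.cosh l
          + (∑ v, kraw t (G.mulVec v + y)) * Real.sinh l) := by
  have h1 : ∀ s, Real.exp (l * sgn (s ⬝ᵥ y))
      = sgn (s ⬝ᵥ 0) * Real.cosh l + sgn (s ⬝ᵥ y) * Real.sinh l := by
    intro s
    rw [dotProduct_zero, sgn_zero, one_mul]
    unfold sgn
    split_ifs
    · rw [mul_one, one_mul, Real.cosh_add_sinh]
    · rw [mul_neg_one, neg_one_mul, ← sub_eq_add_neg, Real.cosh_sub_sinh]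
  simp only [h1, Finset.sum_add_distrib, ← Finset.sum_mul]
  rw [mul_add, ← mul_assoc, sum_sparseDual_sgn t G ht, ← mul_assoc, sum_sparseDual_sgn t G ht]
  simp only [add_zero]
  ring

/-! ### The LDPC distribution: point masses, kernels and independent rows. -/

theorem ldpc_apply {n d t r : ℕ} (ht : t ≤ n) (H : Matrix (Fin r) (Fin n) (ZMod 2))
    (G : Matrix (Fin n) (Fin d) (ZMod 2)) :
    (ldpc n d t r ht (H, G)).toReal
      = if H ∈ rowSparse t r n ∧ H * G = 0 then
          ((rowSparse t r n).card : ℝ)⁻¹ * ((kernelMatrices H d).card : ℝ)⁻¹ else 0 := by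
  have h : ldpc n d t r ht (H, G)
      = PMF.uniformOfFinset (rowSparse t r n) (rowSparse_nonempty r ht) H
        * PMF.uniformOfFinset (kernelMatrices H d) (kernelMatrices_nonempty H d) G := by
    rw [ldpc, PMF.bind_apply, tsum_eq_single H]
    · congr 1
      rw [PMF.bind_apply, tsum_eq_single G]
      · simp
      · intro G' hG'
        rw [PMF.pure_apply, if_neg (by simpa using Ne.symm hG'), mul_zero]
    · intro H' hH'
      rw [PMF.bind_apply]
      simp [Ne.symm hH']
  rw [h, PMF.uniformOfFinset_apply, PMF.uniformOfFinset_apply]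
  have : G ∈ kernelMatrices H d ↔ H * G = 0 := by simp [kernelMatrices]
  simp only [this]
  by_cases h1 : H ∈ rowSparse t r n <;> by_cases h2 : H * G = 0 <;> simp [h1, h2]

/-- The fibers of an additive map are no larger than its kernel. -/
theorem card_le_card_ker_mul {A B : Type*} [AddCommGroup A] [AddCommGroup B] [Fintype A]
    [Fintype B] [DecidableEq A] [DecidableEq B] (f : A →+ B) :
    Fintype.card A ≤ (Finset.univ.filter fun a => f a = 0).card * Fintype.card B := by
  rw [← Finset.card_univ, ← Finset.card_univ]
  refine Finset.card_le_mul_card_image_of_maps_to (f := f) (fun a _ => Finset.mem_univ _) _ ?_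
  intro b _
  rcases (Finset.univ.filter fun a => f a = b).eq_empty_or_nonempty with h | ⟨a₀, h₀⟩
  · simp [h]
  · have h₀ := (Finset.mem_filter.mp h₀).2
    refine Finset.card_le_card_of_injOn (fun a => a - a₀) (fun a ha => ?_)
      fun a _ a' _ h => sub_left_injective h
    have ha := (Finset.mem_filter.mp ha).2
    simp [ha, h₀]

theorem card_binMatrix (n d : ℕ) :
    Fintype.card (Matrix (Fin n) (Fin d) (ZMod 2)) = 2 ^ (n * d) := by
  rw [Fintype.card_congr (Matrix.of (m := Fin n) (n := Fin d) (α := ZMod 2)).symm]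
  simp [ZMod.card, ← pow_mul, mul_comm]

theorem two_pow_le_card_kernelMatrices {r n : ℕ} (H : Matrix (Fin r) (Fin n) (ZMod 2)) (d : ℕ) :
    (2 : ℝ) ^ (n * d) ≤ (kernelMatrices H d).card * 2 ^ (r * d) := by
  have h := card_le_card_ker_mul
    (A := Matrix (Fin n) (Fin d) (ZMod 2)) (B := Matrix (Fin r) (Fin d) (ZMod 2))
    ⟨⟨fun G => H * G, Matrix.mul_zero H⟩, fun G G' => Matrix.mul_add H G G'⟩
  simp only [card_binMatrix] at h
  exact_mod_cast h

/-- The words killed by the parity checks `H`. -/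
def kernelWords {r n : ℕ} (H : Matrix (Fin r) (Fin n) (ZMod 2)) : Finset (BinWord n) :=
  Finset.univ.filter fun y => H.mulVec y = 0

theorem two_pow_le_card_kernelWords {r n : ℕ} (H : Matrix (Fin r) (Fin n) (ZMod 2)) :
    (2 : ℝ) ^ n ≤ (kernelWords H).card * 2 ^ r := by
  have h := card_le_card_ker_mul (A := BinWord n) (B := BinWord r)
    ⟨⟨fun y => H.mulVec y, Matrix.mulVec_zero H⟩, fun G G' => Matrix.mulVec_add H G G'⟩
  simp only [Fintype.card_pi, Finset.prod_const, Finset.card_univ, Fintype.card_fin,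
    ZMod.card] at h
  exact_mod_cast h

theorem exists_dotProduct_eq_one {d : ℕ} {u : BinWord d} (hu : u ≠ 0) :
    ∃ c : BinWord d, c ⬝ᵥ u = 1 := by
  obtain ⟨i, hi⟩ := Function.ne_iff.mp hu
  refine ⟨Pi.single i 1, ?_⟩
  rw [single_dotProduct, one_mul]
  exact (by decide : ∀ a : ZMod 2, a ≠ 0 → a = 1) _ hi

/-- This is the uniformity of `G u` on the kernel of `H`. With `c · u = 1`, adding the rank-one
matrix `(y' - y) cᵀ` injects the fiber over `y` into the fiber over any other kernel word `y'`. -/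
theorem card_fiber_mul_card_kernelWords_le {r n d : ℕ} (H : Matrix (Fin r) (Fin n) (ZMod 2))
    {u : BinWord d} (hu : u ≠ 0) (y : BinWord n) :
    ((kernelMatrices H d).filter fun G => G.mulVec u = y).card * (kernelWords H).card
      ≤ (kernelMatrices H d).card := by
  obtain ⟨c, hc⟩ := exists_dotProduct_eq_one hu
  rcases ((kernelMatrices H d).filter fun G => G.mulVec u = y).eq_empty_or_nonempty
    with h | ⟨G₀, h₀⟩
  · simp [h]
  have hy : H.mulVec y = 0 := by
    obtain ⟨h1, h2⟩ := Finset.mem_filter.mp h₀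
    rw [← h2, Matrix.mulVec_mulVec, (Finset.mem_filter.mp h1).2, Matrix.zero_mulVec]
  have hmaps : ∀ G ∈ kernelMatrices H d, G.mulVec u ∈ kernelWords H := by
    intro G hG
    simp only [kernelWords, Finset.mem_filter, Finset.mem_univ, true_and]
    rw [Matrix.mulVec_mulVec, (Finset.mem_filter.mp hG).2, Matrix.zero_mulVec]
  rw [Finset.card_eq_sum_card_fiberwise hmaps, mul_comm, ← smul_eq_mul]
  refine Finset.card_nsmul_le_sum _ _ _ fun y' hy' => ?_
  have hy' := (Finset.mem_filter.mp hy').2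
  refine Finset.card_le_card_of_injOn (fun G => G + Matrix.vecMulVec (y' - y) c) (fun G hG => ?_)
    fun G _ G' _ h => add_left_injective _ h
  obtain ⟨h1, h2⟩ := Finset.mem_filter.mp hG
  have h1 := (Finset.mem_filter.mp h1).2
  simp only [Finset.coe_filter, kernelMatrices, Finset.mem_filter, Finset.mem_univ, true_and,
    Set.mem_ofPred_eq]
  constructor
  · rw [Matrix.mul_add, h1, Matrix.mul_vecMulVec, Matrix.mulVec_sub, hy, hy', sub_zero,
      Matrix.zero_vecMulVec, add_zero]
  · rw [Matrix.add_mulVec, h2, Matrix.vecMulVec_mulVec, hc]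
    simp

open Classical in
/-- The matrices all of whose rows lie in `S`. -/
def rowsIn {n : ℕ} (r : ℕ) (S : Finset (BinWord n)) : Finset (Matrix (Fin r) (Fin n) (ZMod 2)) :=
  Finset.univ.filter fun H => ∀ i, H i ∈ S

theorem mem_rowsIn {n r : ℕ} {S : Finset (BinWord n)} {H : Matrix (Fin r) (Fin n) (ZMod 2)} :
    H ∈ rowsIn r S ↔ ∀ i, H i ∈ S := by
  simp [rowsIn]

theorem sum_rowsIn_prod {n : ℕ} (r : ℕ) (S : Finset (BinWord n)) (f : BinWord n → ℝ) :
    ∑ H ∈ rowsIn r S, ∏ i, f (H i) = (∑ s ∈ S, f s) ^ r := by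
  have h := Finset.sum_prod_piFinset S (fun _ : Fin r => f)
  rw [Finset.prod_const, Finset.card_univ, Fintype.card_fin] at h
  rw [← h]
  refine Finset.sum_equiv Matrix.of.symm (fun H => ?_) fun H _ => rfl
  rw [Fintype.mem_piFinset, mem_rowsIn]
  rfl

theorem card_rowsIn {n : ℕ} (r : ℕ) (S : Finset (BinWord n)) :
    ((rowsIn r S).card : ℝ) = (S.card : ℝ) ^ r := by
  have := sum_rowsIn_prod r S (fun _ => 1)
  simpa using this

theorem rowSparse_eq_rowsIn (t r n : ℕ) : rowSparse t r n = rowsIn r (sparseVectors t n) := by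
  ext H
  simp [rowSparse, sparseVectors, mem_rowsIn]

theorem card_rowSparse (t r n : ℕ) :
    ((rowSparse t r n).card : ℝ) = ((sparseVectors t n).card : ℝ) ^ r := by
  rw [rowSparse_eq_rowsIn, card_rowsIn]

theorem mem_rowsIn_sparseDual {n d t r : ℕ} (G : Matrix (Fin n) (Fin d) (ZMod 2))
    (H : Matrix (Fin r) (Fin n) (ZMod 2)) :
    H ∈ rowsIn r (sparseDual t G) ↔ H ∈ rowSparse t r n ∧ H * G = 0 := by
  simp only [rowSparse_eq_rowsIn, mem_rowsIn, sparseDual, Finset.mem_filter, forall_and]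
  refine and_congr_right fun _ => ?_
  rw [← Matrix.ext_iff]
  simp only [funext_iff]
  rfl

theorem card_rowSparse_mulVec_eq_zero {n : ℕ} {t : ℕ} (r : ℕ) (ht : t ≤ n) (y : BinWord n) :
    (((rowSparse t r n).filter fun H => H.mulVec y = 0).card : ℝ)
      = ((rowSparse t r n).card : ℝ) * ((1 + kraw t y) / 2) ^ r := by
  have h1 : ((rowSparse t r n).filter fun H => H.mulVec y = 0)
      = rowsIn r ((sparseVectors t n).filter fun s => s ⬝ᵥ y = 0) := by
    ext H
    rw [Finset.mem_filter, rowSparse_eq_rowsIn]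
    simp only [mem_rowsIn, Finset.mem_filter, forall_and]
    refine and_congr_right fun _ => ?_
    rw [funext_iff]
    rfl
  rw [h1, card_rowSparse, card_rowsIn, ← mul_pow]
  congr 1
  have hc : ((sparseVectors t n).card : ℝ) ≠ 0 := by
    exact_mod_cast (sparseVectors_nonempty ht).card_ne_zero
  rw [kraw, Finset.card_filter]
  push_cast
  have h2 : ∀ s, (if s ⬝ᵥ y = 0 then (1 : ℝ) else 0) = (1 + sgn (s ⬝ᵥ y)) / 2 := by
    intro s; unfold sgn; split_ifs <;> norm_num
  simp only [h2]
  rw [← Finset.sum_div, Finset.sum_add_distrib, Finset.sum_const, nsmul_eq_mul, mul_one]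
  field_simp

theorem sum_mul_sum_comm {A B U Y : Type*} (a : Finset A) (b : Finset B) (u : Finset U)
    (y : Finset Y) (f : A → B → ℝ) (g : B → U → Y → ℝ) :
    ∑ i ∈ a, ∑ j ∈ b, f i j * ∑ k ∈ u, ∑ l ∈ y, g j k l
      = ∑ k ∈ u, ∑ l ∈ y, ∑ i ∈ a, ∑ j ∈ b, f i j * g j k l := by
  simp only [Finset.mul_sum]
  calc ∑ i ∈ a, ∑ j ∈ b, ∑ k ∈ u, ∑ l ∈ y, f i j * g j k l
      = ∑ i ∈ a, ∑ k ∈ u, ∑ l ∈ y, ∑ j ∈ b, f i j * g j k l := by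
        refine Finset.sum_congr rfl fun i _ => ?_
        rw [Finset.sum_comm]
        exact Finset.sum_congr rfl fun k _ => Finset.sum_comm
    _ = _ := by
        rw [Finset.sum_comm]
        exact Finset.sum_congr rfl fun k _ => Finset.sum_comm

/-! ### Exponential moments for a fixed generator matrix. -/

/-- The kernel of `H` has dimension at least `n - r` whatever the rank, so the mass is dominated by
a constant on matrices with rows in `sparseDual t G`. The dominating weight is a product over rows,
which restores independence for fixed `G`. -/
theorem ldpc_le {n d t r : ℕ} (ht : t ≤ n) (H : Matrix (Fin r) (Fin n) (ZMod 2))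
    (G : Matrix (Fin n) (Fin d) (ZMod 2)) :
    (ldpc n d t r ht (H, G)).toReal
      ≤ if H ∈ rowsIn r (sparseDual t G) then
          (2 ^ (n * d))⁻¹ * (2 ^ d / (sparseVectors t n).card : ℝ) ^ r else 0 := by
  simp only [ldpc_apply, mem_rowsIn_sparseDual]
  split_ifs
  · have hk : (0 : ℝ) < (kernelMatrices H d).card := by
      exact_mod_cast (kernelMatrices_nonempty H d).card_pos
    have hs : (0 : ℝ) < (sparseVectors t n).card := by
      exact_mod_cast (sparseVectors_nonempty ht).card_pos
    have h := two_pow_le_card_kernelMatrices H d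
    rw [card_rowSparse, div_pow, ← pow_mul, mul_comm d r]
    rw [div_eq_mul_inv, ← mul_assoc, mul_comm]
    gcongr
    rw [inv_mul_eq_div, inv_le_comm₀ hk (by positivity), inv_div, div_le_iff₀ (by positivity)]
    exact h
  · exact le_rfl

/-- Chernoff's method: `f` will be the indicator of a detector error, dominated by an exponential of
the sign sum that factors over the rows. -/
theorem sum_ldpc_mul_le {n d t r : ℕ} (ht : t ≤ n) (G : Matrix (Fin n) (Fin d) (ZMod 2))
    (y : BinWord n) (l θ : ℝ) (f : Matrix (Fin r) (Fin n) (ZMod 2) → ℝ)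
    (hf0 : ∀ H, 0 ≤ f H) (hf : ∀ H, f H ≤ Real.exp (l * signSum (H.mulVec y) - θ)) :
    ∑ H, (ldpc n d t r ht (H, G)).toReal * f H
      ≤ (2 ^ (n * d))⁻¹ * (((∑ v, kraw t (G.mulVec v)) * Real.cosh l
          + (∑ v, kraw t (G.mulVec v + y)) * Real.sinh l) ^ r * Real.exp (-θ)) := by
  have hs : (0 : ℝ) < (sparseVectors t n).card := by
    exact_mod_cast (sparseVectors_nonempty ht).card_pos
  have he : ∀ H : Matrix (Fin r) (Fin n) (ZMod 2), Real.exp (l * signSum (H.mulVec y) - θ)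
      = (∏ i, Real.exp (l * sgn (H i ⬝ᵥ y))) * Real.exp (-θ) := by
    intro H
    rw [← Real.exp_sum, ← Real.exp_add, signSum, ← Finset.mul_sum, sub_eq_add_neg]
    rfl
  calc ∑ H, (ldpc n d t r ht (H, G)).toReal * f H
      ≤ ∑ H, (if H ∈ rowsIn r (sparseDual t G) then
          (2 ^ (n * d))⁻¹ * (2 ^ d / (sparseVectors t n).card : ℝ) ^ r else 0)
          * ((∏ i, Real.exp (l * sgn (H i ⬝ᵥ y))) * Real.exp (-θ)) := by
        refine Finset.sum_le_sum fun H _ => ?_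
        exact mul_le_mul (ldpc_le ht H G) ((hf H).trans (he H).le) (hf0 H) (by positivity)
    _ = (2 ^ (n * d))⁻¹ * ((2 ^ d / (sparseVectors t n).card : ℝ) ^ r
          * (∑ H ∈ rowsIn r (sparseDual t G),
              ∏ i, Real.exp (l * sgn (H i ⬝ᵥ y))) * Real.exp (-θ)) := by
        simp only [ite_mul, zero_mul]
        rw [Finset.sum_ite_mem, Finset.univ_inter, Finset.mul_sum, Finset.sum_mul, Finset.mul_sum]
        exact Finset.sum_congr rfl fun H _ => by ring
    _ = _ := by
        rw [sum_rowsIn_prod r (sparseDual t G) (fun s => Real.exp (l * sgn (s ⬝ᵥ y))), ← mul_pow, div_mul_eq_mul_div, sum_sparseDual_exp t G ht,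
          mul_div_cancel_left₀ _ hs.ne']

/-! ### Generator matrices have low bias with high probability. -/

/-- Union bound over `u` and `y = G u`. The word `y` lies in the kernel with probability `((1 + kraw
t y) / 2) ^ r`, and is then hit with probability at most `2 ^ r / 2 ^ n`; the powers `2 ^ r` cancel.
-/
theorem sum_ldpc_not_lowBias_le {n d t r : ℕ} (ht : t ≤ n) (μ : ℝ) :
    ∑ H, ∑ G, (ldpc n d t r ht (H, G)).toReal * (open Classical in if LowBias μ G then 0 else 1)
      ≤ 2 ^ d * ((2 ^ n)⁻¹ * ∑ y : BinWord n with μ < |bias y|, (1 + kraw t y) ^ r) := by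
  classical
  set R := (rowSparse t r n).card with hR
  have hR0 : (0 : ℝ) < R := by exact_mod_cast (rowSparse_nonempty r ht).card_pos
  have key : ∀ u : BinWord d, u ≠ 0 → ∀ y : BinWord n,
      ∑ H, ∑ G, (ldpc n d t r ht (H, G)).toReal * (if G.mulVec u = y then 1 else 0)
        ≤ (2 ^ n)⁻¹ * (1 + kraw t y) ^ r := by
    intro u hu y
    have h1 : ∀ H : Matrix (Fin r) (Fin n) (ZMod 2),
        ∑ G, (ldpc n d t r ht (H, G)).toReal * (if G.mulVec u = y then 1 else 0)
        ≤ if H ∈ (rowSparse t r n).filter fun H => H.mulVec y = 0 then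
            (R : ℝ)⁻¹ * (2 ^ r / 2 ^ n) else 0 := by
      intro H
      have hk : (0 : ℝ) < (kernelMatrices H d).card := by
        exact_mod_cast (kernelMatrices_nonempty H d).card_pos
      have e : ∑ G, (ldpc n d t r ht (H, G)).toReal * (if G.mulVec u = y then 1 else 0)
          = if H ∈ rowSparse t r n then (R : ℝ)⁻¹ * ((kernelMatrices H d).card : ℝ)⁻¹
            * ((kernelMatrices H d).filter fun G => G.mulVec u = y).card else 0 := by
        simp only [ldpc_apply]
        split_ifs with hH
        · rw [Finset.card_filter, kernelMatrices, Finset.sum_filter]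
          push_cast
          rw [Finset.mul_sum]
          refine Finset.sum_congr rfl fun G _ => ?_
          simp only [hH, true_and]
          split_ifs <;> simp [← hR]
        · simp [hH]
      rw [e]
      simp only [Finset.mem_filter]
      by_cases hH : H ∈ rowSparse t r n
      · rw [if_pos hH]
        by_cases hy : H.mulVec y = 0
        · rw [if_pos ⟨hH, hy⟩, mul_assoc]
          gcongr
          have h2 : (((kernelMatrices H d).filter fun G => G.mulVec u = y).card : ℝ)
              * (kernelWords H).card ≤ (kernelMatrices H d).card := by
            exact_mod_cast card_fiber_mul_card_kernelWords_le H hu y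
          have h3 := two_pow_le_card_kernelWords H
          rw [inv_mul_eq_div, div_le_div_iff₀ hk (by positivity)]
          calc (((kernelMatrices H d).filter fun G => G.mulVec u = y).card : ℝ) * 2 ^ n
              ≤ ((kernelMatrices H d).filter fun G => G.mulVec u = y).card
                * ((kernelWords H).card * 2 ^ r) := by gcongr
            _ = (((kernelMatrices H d).filter fun G => G.mulVec u = y).card
                * (kernelWords H).card) * 2 ^ r := by ring
            _ ≤ (kernelMatrices H d).card * 2 ^ r := by gcongr
            _ = _ := mul_comm _ _
        · rw [if_neg (fun h => hy h.2)]
          have : ((kernelMatrices H d).filter fun G => G.mulVec u = y) = ∅ := by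
            refine Finset.filter_eq_empty_iff.mpr fun G hG h => hy ?_
            rw [← h, Matrix.mulVec_mulVec, (Finset.mem_filter.mp hG).2, Matrix.zero_mulVec]
          simp [this]
      · rw [if_neg hH, if_neg (fun h => hH h.1)]
    refine (Finset.sum_le_sum fun H _ => h1 H).trans ?_
    rw [Finset.sum_ite_mem, Finset.univ_inter, Finset.sum_const, nsmul_eq_mul,
      card_rowSparse_mulVec_eq_zero r ht y, div_pow, ← hR]
    apply le_of_eq
    field_simp
  have hind : ∀ G : Matrix (Fin n) (Fin d) (ZMod 2), (if LowBias μ G then (0 : ℝ) else 1)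
      ≤ ∑ u ∈ Finset.univ.filter (fun u : BinWord d => u ≠ 0),
          ∑ y : BinWord n with μ < |bias y|, if G.mulVec u = y then 1 else 0 := by
    intro G
    split_ifs with hG
    · positivity
    · simp only [LowBias, not_forall, not_le] at hG
      obtain ⟨u, hu, hb⟩ := hG
      refine le_trans ?_ (Finset.single_le_sum (fun u _ => by positivity)
        (by simpa using hu : u ∈ Finset.univ.filter (fun u : BinWord d => u ≠ 0)))
      refine le_trans ?_ (Finset.single_le_sum (fun u _ => by positivity)
        (by simpa using hb : G.mulVec u ∈ Finset.univ.filter (fun y : BinWord n => μ < |bias y|)))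
      simp
  calc ∑ H, ∑ G, (ldpc n d t r ht (H, G)).toReal * (if LowBias μ G then 0 else 1)
      ≤ ∑ H, ∑ G, (ldpc n d t r ht (H, G)).toReal
          * ∑ u ∈ Finset.univ.filter (fun u : BinWord d => u ≠ 0),
          ∑ y : BinWord n with μ < |bias y|, (if G.mulVec u = y then 1 else 0) := by
        refine Finset.sum_le_sum fun H _ => Finset.sum_le_sum fun G _ => ?_
        exact mul_le_mul_of_nonneg_left (hind G) ENNReal.toReal_nonneg
    _ = ∑ u ∈ Finset.univ.filter (fun u : BinWord d => u ≠ 0),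
          ∑ y : BinWord n with μ < |bias y|, ∑ H, ∑ G, (ldpc n d t r ht (H, G)).toReal
          * (if G.mulVec u = y then 1 else 0) := by
        exact sum_mul_sum_comm _ _ _ _ _ _
    _ ≤ ∑ u ∈ Finset.univ.filter (fun u : BinWord d => u ≠ 0),
          ∑ y : BinWord n with μ < |bias y|, (2 ^ n)⁻¹ * (1 + kraw t y) ^ r := by
        refine Finset.sum_le_sum fun u hu => Finset.sum_le_sum fun y _ => ?_
        exact key u (Finset.mem_filter.mp hu).2 y
    _ ≤ _ := by
        rw [Finset.sum_const, nsmul_eq_mul, ← Finset.mul_sum]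
        have : 0 ≤ ∑ y : BinWord n with μ < |bias y|, (1 + kraw t y) ^ r :=
          Finset.sum_nonneg fun y _ => pow_nonneg (by linarith [neg_le_of_abs_le (abs_kraw_le_one t y)]) _
        gcongr
        refine (Nat.cast_le.mpr (Finset.card_le_univ _)).trans ?_
        simp [ZMod.card]

theorem sum_exp_signSum {n : ℕ} (l : ℝ) :
    ∑ y : BinWord n, Real.exp (l * signSum y) = (Real.exp l + Real.exp (-l)) ^ n := by
  have h : ∀ y : BinWord n, Real.exp (l * signSum y) = ∏ i, Real.exp (l * sgn (y i)) := fun y => by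
    rw [signSum, Finset.mul_sum, Real.exp_sum]
  simp only [h]
  rw [← Fintype.prod_sum (fun (_ : Fin n) (a : ZMod 2) => Real.exp (l * sgn a))]
  rw [Finset.prod_const, Finset.card_univ, Fintype.card_fin,
    show (Finset.univ : Finset (ZMod 2)) = {0, 1} from rfl, Finset.sum_pair zero_ne_one]
  simp [sgn]

theorem card_le_abs_bias_le {n : ℕ} (hn : 0 < n) {l : ℝ} (hl : 0 ≤ l) (b : ℝ) :
    ((Finset.univ.filter fun y : BinWord n => b ≤ |bias y|).card : ℝ)
      ≤ 2 * ((Real.exp l + Real.exp (-l)) * Real.exp (-(l * b))) ^ n := by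
  have hn0 : (0 : ℝ) < n := by exact_mod_cast hn
  have h1 : ∀ y ∈ Finset.univ.filter (fun y : BinWord n => b ≤ |bias y|),
      (1 : ℝ) ≤ (Real.exp (l * signSum y) + Real.exp (-l * signSum y))
        * Real.exp (-(l * b)) ^ n := by
    intro y hy
    have hy := (Finset.mem_filter.mp hy).2
    have hb : b * n ≤ |signSum y| := by
      rw [bias, abs_div, Nat.abs_cast, le_div_iff₀ hn0] at hy
      exact hy
    have h2 : Real.exp (l * |signSum y|)
        ≤ Real.exp (l * signSum y) + Real.exp (-l * signSum y) := by
      rcases abs_choice (signSum y) with h | h <;> rw [h]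
      · linarith [Real.exp_pos (-l * signSum y)]
      · rw [mul_neg, ← neg_mul]; linarith [Real.exp_pos (l * signSum y)]
    rw [← Real.exp_nat_mul]
    calc (1 : ℝ) = Real.exp 0 := Real.exp_zero.symm
      _ ≤ Real.exp (l * |signSum y| + n * -(l * b)) := by
        rw [Real.exp_le_exp]; nlinarith
      _ = Real.exp (l * |signSum y|) * Real.exp (n * -(l * b)) := Real.exp_add _ _
      _ ≤ _ := by gcongr
  calc ((Finset.univ.filter fun y : BinWord n => b ≤ |bias y|).card : ℝ)
      = ∑ y : BinWord n with b ≤ |bias y|, (1 : ℝ) := by simp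
    _ ≤ ∑ y : BinWord n with b ≤ |bias y|,
        (Real.exp (l * signSum y) + Real.exp (-l * signSum y)) * Real.exp (-(l * b)) ^ n :=
        Finset.sum_le_sum h1
    _ ≤ ∑ y : BinWord n,
        (Real.exp (l * signSum y) + Real.exp (-l * signSum y)) * Real.exp (-(l * b)) ^ n :=
        Finset.sum_le_sum_of_subset_of_nonneg (Finset.filter_subset _ _)
          fun y _ _ => by positivity
    _ = _ := by
        rw [← Finset.sum_mul, Finset.sum_add_distrib, sum_exp_signSum, sum_exp_signSum, neg_neg,
          add_comm (Real.exp (-l)), mul_pow]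
        ring

theorem card_le_abs_bias_le_exp {n : ℕ} (hn : 0 < n) {b : ℝ} (hb : 0 ≤ b) :
    ((Finset.univ.filter fun y : BinWord n => b ≤ |bias y|).card : ℝ)
      ≤ 2 ^ n * (2 * Real.exp (-(n * b ^ 2 / 2))) := by
  -- The Chernoff parameter is `l = b`, optimal for the Gaussian bound on `cosh`.
  refine (card_le_abs_bias_le hn hb b).trans ?_
  have h1 : (Real.exp b + Real.exp (-b)) * Real.exp (-(b * b)) ≤ 2 * Real.exp (-(b ^ 2 / 2)) := by
    have h2 := Real.cosh_le_exp_half_sq b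
    rw [Real.cosh_eq] at h2
    calc _ ≤ (2 * Real.exp (b ^ 2 / 2)) * Real.exp (-(b * b)) := by gcongr; linarith
      _ = _ := by rw [mul_assoc, ← Real.exp_add]; congr 2; ring
  calc _ ≤ 2 * (2 * Real.exp (-(b ^ 2 / 2))) ^ n := by gcongr
    _ = _ := by
      rw [mul_pow, ← Real.exp_nat_mul, show (n : ℝ) * -(b ^ 2 / 2) = -(n * b ^ 2 / 2) by ring]
      ring

/-- At moderate bias `kraw t y` is at most a quarter of the squared bias, so the factor costs only
half of the Hoeffding exponent `n b² / 2`. -/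
theorem one_add_kraw_pow_le {n t r : ℕ} (hn : 0 < n) (ht2 : 2 ≤ t) (ht : 2 * t ≤ n) (hr : r ≤ n)
    {μ b₀ : ℝ} (hμ : 16 * (t : ℝ) ^ 2 ≤ n * μ ^ 2) (hμ0 : 0 ≤ μ) (hb₀ : b₀ ^ (t - 2) ≤ 1 / 8)
    {y : BinWord n} (hy : μ < |bias y|) (hy' : |bias y| ≤ b₀) :
    (1 + kraw t y) ^ r ≤ Real.exp (n * |bias y| ^ 2 / 4) := by
  have hn0 : (0 : ℝ) < n := by exact_mod_cast hn
  have hr0 : (r : ℝ) ≤ n := by exact_mod_cast hr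
  have h1 := (abs_le.mp (abs_kraw_sub_pow_le ht y)).2
  have h2 : bias y ^ t ≤ |bias y| ^ 2 / 8 := by
    calc bias y ^ t ≤ |bias y ^ t| := le_abs_self _
      _ = |bias y| ^ 2 * |bias y| ^ (t - 2) := by rw [abs_pow, ← pow_add]; congr 1; omega
      _ ≤ |bias y| ^ 2 * (1 / 8) := by
        gcongr
        exact (pow_le_pow_left₀ (abs_nonneg _) hy' _).trans hb₀
      _ = _ := by ring
  have h3 : 2 * (t : ℝ) ^ 2 / n ≤ |bias y| ^ 2 / 8 := by
    rw [div_le_iff₀ hn0]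
    have : μ ^ 2 ≤ |bias y| ^ 2 := by gcongr
    nlinarith
  have h4 : 0 ≤ 1 + kraw t y := by linarith [neg_le_of_abs_le (abs_kraw_le_one t y)]
  calc (1 + kraw t y) ^ r ≤ Real.exp (|bias y| ^ 2 / 4) ^ r := by
        gcongr
        have := Real.add_one_le_exp (|bias y| ^ 2 / 4)
        linarith
    _ = Real.exp (r * (|bias y| ^ 2 / 4)) := (Real.exp_nat_mul _ _).symm
    _ ≤ _ := by
        rw [Real.exp_le_exp]
        have : 0 ≤ |bias y| ^ 2 / 4 := by positivity
        nlinarith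

theorem sum_biased_one_add_kraw_le {n t r : ℕ} (hn : 0 < n) (ht2 : 2 ≤ t) (ht : 2 * t ≤ n)
    (hr : r ≤ n) {μ b₀ l : ℝ} (hμ : 16 * (t : ℝ) ^ 2 ≤ n * μ ^ 2) (hμ0 : 0 ≤ μ)
    (hb₀ : b₀ ^ (t - 2) ≤ 1 / 8) (hl : 0 ≤ l) :
    (2 ^ n)⁻¹ * ∑ y : BinWord n with μ < |bias y|, (1 + kraw t y) ^ r
      ≤ (n + 1) * (2 * Real.exp (-(n * μ ^ 2 / 4)))
        + 2 * (2 ^ r * ((Real.exp l + Real.exp (-l)) * Real.exp (-(l * b₀)) / 2) ^ n) := by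
  have hn0 : (0 : ℝ) < n := by exact_mod_cast hn
  rw [inv_mul_le_iff₀ (by positivity), ← Finset.sum_filter_add_sum_filter_not _
    (fun y : BinWord n => |bias y| ≤ b₀), mul_add]
  refine add_le_add ?_ ?_
  -- The bias is constant on each weight class, so Hoeffding applies at the exact bias of the class;
  -- there are `n + 1` classes.
  · rw [← Finset.sum_fiberwise_of_maps_to (g := fun y : BinWord n => hammingNorm y)
      (t := Finset.range (n + 1)) (fun y _ => Finset.mem_range.mpr
        (Nat.lt_succ_of_le (by simpa using hammingNorm_le_card_fintype (x := y))))]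
    refine (Finset.sum_le_card_nsmul _ _ (2 ^ n * (2 * Real.exp (-(n * μ ^ 2 / 4))))
      fun w _ => ?_).trans ?_
    · set F := ((Finset.univ.filter fun y : BinWord n => μ < |bias y|).filter
        (fun y : BinWord n => |bias y| ≤ b₀)).filter (fun y => hammingNorm y = w) with hF
      rcases F.eq_empty_or_nonempty with h | ⟨y₀, hy₀⟩
      · rw [h, Finset.sum_empty]; positivity
      have hmem : ∀ y ∈ F, μ < |bias y| ∧ |bias y| ≤ b₀ ∧ bias y = bias y₀ := by
        intro y hy
        simp only [hF, Finset.mem_filter, Finset.mem_univ, true_and] at hy hy₀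
        exact ⟨hy.1.1, hy.1.2, by rw [bias, bias, signSum_eq, signSum_eq, hy.2, hy₀.2]⟩
      calc ∑ y ∈ F, (1 + kraw t y) ^ r
          ≤ F.card • Real.exp (n * |bias y₀| ^ 2 / 4) := by
            refine Finset.sum_le_card_nsmul _ _ _ fun y hy => ?_
            obtain ⟨h1, h2, h3⟩ := hmem y hy
            rw [← h3]
            exact one_add_kraw_pow_le hn ht2 ht hr hμ hμ0 hb₀ h1 h2
        _ ≤ (2 ^ n * (2 * Real.exp (-(n * |bias y₀| ^ 2 / 2))))
              * Real.exp (n * |bias y₀| ^ 2 / 4) := by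
            rw [nsmul_eq_mul]
            gcongr
            refine le_trans ?_ (card_le_abs_bias_le_exp hn (abs_nonneg (bias y₀)))
            refine Nat.cast_le.mpr (Finset.card_le_card fun y hy => ?_)
            simp [(hmem y hy).2.2]
        _ = 2 ^ n * (2 * Real.exp (-(n * |bias y₀| ^ 2 / 4))) := by
            rw [mul_assoc, mul_assoc, ← Real.exp_add]
            congr 3; ring
        _ ≤ _ := by
            have := (hmem y₀ hy₀).1
            gcongr
    · rw [Finset.card_range, nsmul_eq_mul]
      push_cast
      apply le_of_eq; ring
  -- Near bias 1 only `kraw ≤ 1` is used. The resulting `2 ^ r` is later outweighed by the scarcity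
  -- of such words, since `r ≤ κ n`.
  · refine (Finset.sum_le_card_nsmul _ _ (2 ^ r) fun y _ => ?_).trans ?_
    · have := abs_le.mp (abs_kraw_le_one t y)
      gcongr
      · linarith
      · linarith
    · rw [nsmul_eq_mul]
      calc _ ≤ (2 * ((Real.exp l + Real.exp (-l)) * Real.exp (-(l * b₀))) ^ n) * 2 ^ r := by
            gcongr
            refine le_trans ?_ (card_le_abs_bias_le hn hl b₀)
            refine Nat.cast_le.mpr (Finset.card_le_card fun y hy => ?_)
            have := (Finset.mem_filter.mp hy).2
            simp only [Finset.mem_filter, Finset.mem_univ, true_and]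
            exact (not_le.mp this).le
        _ = _ := by rw [div_pow]; field_simp

/-- At `b₀ = 1` the expression is `1 + exp (-2 l)`, which tends to 1; continuity in `b₀` then
permits a threshold below 1. By the Chernoff count, words of bias above `b₀` thus number at most `2
c ^ n`. -/
theorem exists_bias_threshold {c : ℝ} (hc : 1 < c) :
    ∃ l b₀ : ℝ, 0 ≤ l ∧ 0 ≤ b₀ ∧ b₀ < 1 ∧
      (Real.exp l + Real.exp (-l)) * Real.exp (-(l * b₀)) ≤ c := by
  have h1 : Tendsto (fun l : ℝ => (Real.exp l + Real.exp (-l)) * Real.exp (-(l * 1))) atTop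
      (nhds 1) := by
    have h2 : (fun l : ℝ => (Real.exp l + Real.exp (-l)) * Real.exp (-(l * 1)))
        = fun l => 1 + Real.exp (-l) * Real.exp (-l) := by
      ext l
      rw [mul_one, add_mul, ← Real.exp_add, add_neg_cancel, Real.exp_zero]
    rw [h2]
    have h3 := Real.tendsto_exp_neg_atTop_nhds_zero
    simpa using tendsto_const_nhds.add (h3.mul h3)
  obtain ⟨l, hl1, hl0⟩ := ((h1.eventually_lt_const hc).and (eventually_ge_atTop 0)).exists
  have h4 : Continuous fun b : ℝ => (Real.exp l + Real.exp (-l)) * Real.exp (-(l * b)) := by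
    fun_prop
  have h5 := (h4.tendsto 1).eventually_lt_const hl1
  have h6 : ∀ᶠ b : ℝ in nhdsWithin 1 (Set.Iio 1), 0 ≤ b ∧ b < 1 :=
    (Filter.Eventually.and (mem_nhdsWithin_of_mem_nhds
      (Filter.mem_of_superset (Ioi_mem_nhds (zero_lt_one' ℝ)) fun x hx =>
        show (0 : ℝ) ≤ x from le_of_lt (Set.mem_Ioi.mp hx)))
      self_mem_nhdsWithin)
  obtain ⟨b, hb, hb'⟩ := (h6.and (h5.filter_mono nhdsWithin_le_nhds)).exists
  exact ⟨l, b, hl0, hb.1, hb.2, hb'.le⟩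

/-! ### Cross biases of two generator matrices. -/

/-- Every sum of a nonzero combination of columns of `G` and a combination of columns of `G'` has
bias at most `μ`. -/
def LowCrossBias {n d : ℕ} (μ : ℝ) (G G' : Matrix (Fin n) (Fin d) (ZMod 2)) : Prop :=
  ∀ u : BinWord d, u ≠ 0 → ∀ v : BinWord d, |bias (G'.mulVec v + G.mulVec u)| ≤ μ

open Classical in
theorem card_not_lowCrossBias_le {n d : ℕ} (hn : 0 < n) {μ : ℝ} (hμ : 0 ≤ μ)
    (G' : Matrix (Fin n) (Fin d) (ZMod 2)) :
    ((Finset.univ.filter fun G : Matrix (Fin n) (Fin d) (ZMod 2) => ¬ LowCrossBias μ G G').card : ℝ)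
      ≤ 2 ^ (n * d) * (2 ^ d * 2 ^ d * (2 * Real.exp (-(n * μ ^ 2 / 2)))) := by
  set B := Finset.univ.filter fun y : BinWord n => μ ≤ |bias y| with hB
  have hfib : ∀ u : BinWord d, u ≠ 0 → ∀ y : BinWord n,
      ((Finset.univ.filter fun G : Matrix (Fin n) (Fin d) (ZMod 2) => G.mulVec u = y).card : ℝ)
        ≤ 2 ^ (n * d) / 2 ^ n := by
    intro u hu y
    -- A uniform `G` is the case of no parity checks, where every word lies in the kernel.
    have h := card_fiber_mul_card_kernelWords_le (d := d) (0 : Matrix (Fin 0) (Fin n) (ZMod 2)) hu y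
    have h1 : kernelMatrices (0 : Matrix (Fin 0) (Fin n) (ZMod 2)) d = Finset.univ := by
      ext G; simp [kernelMatrices]
    have h2 : kernelWords (0 : Matrix (Fin 0) (Fin n) (ZMod 2)) = Finset.univ := by
      ext G; simp [kernelWords]
    rw [h1, h2, Finset.card_univ, Finset.card_univ, card_binMatrix] at h
    simp only [Fintype.card_pi, Finset.prod_const, Finset.card_univ, Fintype.card_fin,
      ZMod.card] at h
    rw [le_div_iff₀ (by positivity)]
    exact_mod_cast h
  have hsub : (Finset.univ.filter fun G : Matrix (Fin n) (Fin d) (ZMod 2) => ¬ LowCrossBias μ G G')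
      ⊆ (Finset.univ.filter fun u : BinWord d => u ≠ 0).biUnion fun u =>
        Finset.univ.biUnion fun v : BinWord d => B.biUnion fun y =>
          Finset.univ.filter fun G => G.mulVec u = y - G'.mulVec v := by
    intro G hG
    have hG := (Finset.mem_filter.mp hG).2
    simp only [LowCrossBias, not_forall, not_le] at hG
    obtain ⟨u, hu, v, huv⟩ := hG
    simp only [Finset.mem_biUnion, Finset.mem_filter, Finset.mem_univ, true_and, hB]
    exact ⟨u, hu, v, _, huv.le, by abel⟩
  have hcu : ((Finset.univ : Finset (BinWord d)).card : ℝ) = 2 ^ d := by simp [ZMod.card]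
  calc ((Finset.univ.filter fun G : Matrix (Fin n) (Fin d) (ZMod 2) =>
          ¬ LowCrossBias μ G G').card : ℝ)
      ≤ ∑ u : BinWord d with u ≠ 0, ∑ v : BinWord d, ∑ y ∈ B,
          ((Finset.univ.filter fun G : Matrix (Fin n) (Fin d) (ZMod 2) =>
            G.mulVec u = y - G'.mulVec v).card : ℝ) := by
        have h := (Finset.card_le_card hsub).trans (Finset.card_biUnion_le.trans
          (Finset.sum_le_sum fun u _ => Finset.card_biUnion_le.trans
            (Finset.sum_le_sum fun v _ => Finset.card_biUnion_le)))
        exact_mod_cast h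
    _ ≤ ∑ u : BinWord d with u ≠ 0, ∑ v : BinWord d, ∑ y ∈ B, (2 ^ (n * d) / 2 ^ n : ℝ) :=
        Finset.sum_le_sum fun u hu => Finset.sum_le_sum fun v _ => Finset.sum_le_sum fun y _ =>
          hfib u (Finset.mem_filter.mp hu).2 _
    _ ≤ 2 ^ d * (2 ^ d * (B.card * (2 ^ (n * d) / 2 ^ n))) := by
        rw [Finset.sum_const, Finset.sum_const, Finset.sum_const, nsmul_eq_mul, nsmul_eq_mul,
          nsmul_eq_mul, hcu]
        gcongr
        rw [← hcu]
        exact Nat.cast_le.mpr (Finset.card_filter_le _ _)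
    _ ≤ 2 ^ d * (2 ^ d * ((2 ^ n * (2 * Real.exp (-(n * μ ^ 2 / 2)))) * (2 ^ (n * d) / 2 ^ n))) := by
        gcongr
        exact card_le_abs_bias_le_exp hn hμ
    _ = _ := by field_simp

/-! ### Error of a single detector on a fixed word. -/

/-- The numerical conditions under which the detectors are reliable on noise of relative weight
`β`, for generator matrices of bias at most `α ^ 2 / 2`. -/
structure Reliable (n d t r : ℕ) (α β x : ℝ) : Prop where
  n_pos : 0 < n
  two_le : 2 ≤ t
  two_mul_le : 2 * t ≤ n
  α_pos : 0 < α
  α_le : α ≤ 1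
  t_le : (t : ℝ) ≤ n * α ^ 2
  β_nonneg : 0 ≤ β
  β_le : 2 * β ≤ 1
  x_nonneg : 0 ≤ x
  x_le : x ≤ 1
  deviation : r * (2 ^ d * (4 * α) ^ t) ≤ 1 / 4
  noise : 2 * (2 * β + α ^ 2 / 2) ^ (t - 2) + 2 / α ^ 2 * (2 * (t : ℝ) ^ 2 / n)
    + 2 ^ d * (4 * α) ^ t ≤ x / 2
  signal : 6 * x ≤ (1 - 2 * β) ^ t - 2 * (t : ℝ) ^ 2 / n

theorem sum_kraw_cosh_sinh_nonneg {n d t : ℕ} (ht : t ≤ n) (G : Matrix (Fin n) (Fin d) (ZMod 2))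
    (y : BinWord n) (l : ℝ) :
    0 ≤ (∑ v, kraw t (G.mulVec v)) * Real.cosh l
          + (∑ v, kraw t (G.mulVec v + y)) * Real.sinh l := by
  have hs : (0 : ℝ) < (sparseVectors t n).card := by
    exact_mod_cast (sparseVectors_nonempty ht).card_pos
  have h := sum_sparseDual_exp t G ht y l
  refine nonneg_of_mul_nonneg_right ?_ hs
  rw [← h]
  positivity

theorem sum_ldpc_mul_le_exp {n d t r : ℕ} (ht : t ≤ n) (G : Matrix (Fin n) (Fin d) (ZMod 2))
    (y : BinWord n) (l θ β : ℝ) (f : Matrix (Fin r) (Fin n) (ZMod 2) → ℝ)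
    (hf0 : ∀ H, 0 ≤ f H) (hf : ∀ H, f H ≤ Real.exp (l * signSum (H.mulVec y) - θ))
    (hβ : (∑ v, kraw t (G.mulVec v)) * Real.cosh l
          + (∑ v, kraw t (G.mulVec v + y)) * Real.sinh l ≤ 1 + β) :
    ∑ H, (ldpc n d t r ht (H, G)).toReal * f H
      ≤ (2 ^ (n * d))⁻¹ * Real.exp (r * β - θ) := by
  refine (sum_ldpc_mul_le ht G y l θ f hf0 hf).trans ?_
  rw [sub_eq_add_neg, Real.exp_add, Real.exp_nat_mul]
  have h0 := sum_kraw_cosh_sinh_nonneg ht G y l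
  gcongr
  linarith [Real.add_one_le_exp β]

theorem cosh_le_one_add_sq {x : ℝ} (h0 : 0 ≤ x) (h1 : x ≤ 1) : Real.cosh x ≤ 1 + x ^ 2 := by
  refine (Real.cosh_le_exp_half_sq x).trans ?_
  have h : |x ^ 2 / 2| ≤ 1 := by rw [abs_of_nonneg (by positivity)]; nlinarith
  have := Real.abs_exp_sub_one_le h
  rw [abs_of_nonneg (by positivity : 0 ≤ x ^ 2 / 2)] at this
  linarith [(abs_le.mp this).2]

theorem sinh_le_two_mul {x : ℝ} (h0 : 0 ≤ x) (h1 : x ≤ 1) : Real.sinh x ≤ 2 * x := by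
  have ha := Real.abs_exp_sub_one_le (x := x) (by rwa [abs_of_nonneg h0])
  have hb := Real.abs_exp_sub_one_le (x := -x) (by rwa [abs_neg, abs_of_nonneg h0])
  rw [abs_neg] at hb
  rw [abs_of_nonneg h0] at ha hb
  rw [Real.sinh_eq]
  linarith [(abs_le.mp ha).2, (abs_le.mp hb).1]

section
variable {n d t r : ℕ} {α β x : ℝ}

theorem Reliable.sum_kraw_le (h : Reliable n d t r α β x) {G : Matrix (Fin n) (Fin d) (ZMod 2)}
    (hG : LowBias (α ^ 2 / 2) G) :
    ∑ v, kraw t (G.mulVec v) ≤ 1 + 2 ^ d * (4 * α) ^ t := by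
  rw [← Finset.add_sum_erase _ _ (Finset.mem_univ (0 : BinWord d))]
  refine add_le_add ((le_abs_self _).trans (abs_kraw_le_one _ _)) ?_
  refine le_trans (Finset.sum_le_sum fun v _ => le_abs_self _) ?_
  exact hG.sum_abs_kraw_le h.two_mul_le h.α_pos h.α_le h.t_le

/-- The moment bound at parameter 0: the marginal mass of a low-bias `G` is at most twice uniform.
This bounds the factor of the other matrix in the game and allows comparison with uniform pairs. -/
theorem Reliable.sum_ldpc_le (h : Reliable n d t r α β x) (ht : t ≤ n)
    {G : Matrix (Fin n) (Fin d) (ZMod 2)} (hG : LowBias (α ^ 2 / 2) G) :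
    ∑ H, (ldpc n d t r ht (H, G)).toReal ≤ 2 * (2 ^ (n * d))⁻¹ := by
  have h1 := sum_ldpc_mul_le_exp (r := r) ht G 0 0 0 (2 ^ d * (4 * α) ^ t) (fun _ => 1)
    (fun _ => zero_le_one) (fun H => by simp) (by simpa using h.sum_kraw_le hG)
  simp only [mul_one, sub_zero] at h1
  refine h1.trans ?_
  rw [mul_comm]
  gcongr
  refine (Real.exp_le_exp.mpr h.deviation).trans ?_
  have := Real.abs_exp_sub_one_le (x := 1 / 4) (by norm_num [abs_of_pos])
  rw [abs_of_pos (by norm_num : (0 : ℝ) < 1 / 4)] at this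
  linarith [(abs_le.mp this).2]

theorem Reliable.exp_le (h : Reliable n d t r α β x) :
    Real.exp (r * (2 * (2 ^ d * (4 * α) ^ t) + 2 * x ^ 2) - 3 * x ^ 2 * r)
      ≤ 2 * Real.exp (-(r * x ^ 2)) := by
  have := Real.abs_exp_sub_one_le (x := 1 / 2) (by norm_num [abs_of_pos])
  rw [abs_of_pos (by norm_num : (0 : ℝ) < 1 / 2)] at this
  calc _ ≤ Real.exp (1 / 2 + -(r * x ^ 2)) := by
        rw [Real.exp_le_exp]
        linarith [h.deviation]
    _ = Real.exp (1 / 2) * Real.exp (-(r * x ^ 2)) := Real.exp_add _ _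
    _ ≤ _ := by
        gcongr
        linarith [(abs_le.mp this).2]

theorem Reliable.dev_nonneg (h : Reliable n d t r α β x) : 0 ≤ 2 ^ d * (4 * α) ^ t := by
  have := h.α_pos
  positivity

theorem Reliable.abs_bias_le (h : Reliable n d t r α β x) {y w : BinWord n}
    (hy : |bias y| ≤ α ^ 2 / 2) (hw : (hammingNorm w : ℝ) ≤ β * n) :
    |bias (y + w)| ≤ 2 * β + α ^ 2 / 2 := by
  have hn0 : (0 : ℝ) < n := by exact_mod_cast h.n_pos
  have h1 := abs_bias_add_sub_le y w
  have h2 := abs_sub_abs_le_abs_sub (bias (y + w)) (bias y)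
  have h3 : 2 * (hammingNorm w : ℝ) / n ≤ 2 * β := by
    rw [div_le_iff₀ hn0]; linarith
  linarith

-- The summand `v = u` is `kraw t w ≥ 6 x`, and all others together cost at most `x / 2`, so the
-- expected sign of a row is well above the threshold `3 x`.
open Classical in
theorem Reliable.sum_not_detects_le (h : Reliable n d t r α β x) (ht : t ≤ n)
    {G : Matrix (Fin n) (Fin d) (ZMod 2)} (hG : LowBias (α ^ 2 / 2) G) (u : BinWord d)
    {w : BinWord n} (hw : (hammingNorm w : ℝ) ≤ β * n) :
    ∑ H, (ldpc n d t r ht (H, G)).toReal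
        * (if Detects (3 / 2 * x) H (G.mulVec u + w) then 0 else 1)
      ≤ (2 ^ (n * d))⁻¹ * (2 * Real.exp (-(r * x ^ 2))) := by
  have hn0 : (0 : ℝ) < n := by exact_mod_cast h.n_pos
  have hx0 := h.x_nonneg
  have hα := h.α_pos
  have hβ0 := h.β_nonneg
  have hB : 5 * x ≤ ∑ v, kraw t (G.mulVec v + (G.mulVec u + w)) := by
    rw [← Finset.add_sum_erase _ _ (Finset.mem_univ u), ← add_assoc, BinWord.add_self, zero_add]
    have h1 := sum_abs_kraw_le h.n_pos h.two_le h.two_mul_le h.α_pos h.t_le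
      (M := 2 * β + α ^ 2 / 2) (by positivity) hG (G.mulVec u + w) (Finset.univ.erase u)
      (fun v hv => by
        rw [← add_assoc, ← Matrix.mulVec_add]
        exact h.abs_bias_le (hG _ fun h' => Finset.ne_of_mem_erase hv (BinWord.add_eq_zero h')) hw)
    have h2 := (Finset.abs_sum_le_sum_abs (fun v => kraw t (G.mulVec v + (G.mulVec u + w)))
      (Finset.univ.erase u)).trans h1
    have h3 := (abs_le.mp h2).1
    have h4 : 6 * x ≤ kraw t w := by
      have h5 := (abs_le.mp (abs_kraw_sub_pow_le h.two_mul_le w)).1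
      have h6 : (1 - 2 * β) ^ t ≤ bias w ^ t := by
        refine pow_le_pow_left₀ (by linarith [h.β_le]) ?_ t
        rw [bias, signSum_eq, le_div_iff₀ hn0]
        linarith
      linarith [h.signal]
    linarith [h.noise]
  -- For threshold `ζ = 3 x / 2`, an error means a sign sum of at most `3 x r`, so the Chernoff
  -- parameter `-x` goes with `θ = -3 x² r`. The `sinh` term gains `5 x²`, `cosh` loses `x²` and the
  -- threshold `3 x²`, leaving `x²` per row.
  refine (sum_ldpc_mul_le_exp ht G (G.mulVec u + w) (-x) (-(3 * x ^ 2 * r))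
    (2 * (2 ^ d * (4 * α) ^ t) - 4 * x ^ 2) _ (fun H => by positivity) (fun H => ?_) ?_).trans ?_
  · split_ifs with hd
    · positivity
    · rw [Detects, not_lt] at hd
      refine Real.one_le_exp ?_
      rw [signSum_eq]
      nlinarith
  · rw [Real.cosh_neg, Real.sinh_neg]
    have h1 := h.sum_kraw_le hG
    have h2 := cosh_le_one_add_sq hx0 h.x_le
    have h3 : x ≤ Real.sinh x := Real.self_le_sinh_iff.mpr hx0
    have h4 : 5 * x * x ≤ (∑ v, kraw t (G.mulVec v + (G.mulVec u + w))) * Real.sinh x := by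
      have : 0 ≤ 5 * x := by positivity
      exact mul_le_mul hB h3 hx0 (this.trans hB)
    have h5 : (∑ v, kraw t (G.mulVec v)) * Real.cosh x
        ≤ (1 + 2 ^ d * (4 * α) ^ t) * (1 + x ^ 2) :=
      mul_le_mul h1 h2 (Real.cosh_pos x).le (by linarith [h.dev_nonneg])
    have h6 : x ^ 2 ≤ 1 := by nlinarith [h.x_le]
    nlinarith [h.dev_nonneg]
  · gcongr
    refine le_trans (Real.exp_le_exp.mpr ?_) h.exp_le
    nlinarith [mul_nonneg (Nat.cast_nonneg (α := ℝ) r) (sq_nonneg x)]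

-- Since `u ≠ 0`, low cross bias keeps every word `G v + G' u + w` at bias at most `2 β + α² / 2`.
-- No summand carries a signal, and the mean sign stays well below the threshold.
open Classical in
theorem Reliable.sum_not_rejects_le (h : Reliable n d t r α β x) (ht : t ≤ n)
    {G : Matrix (Fin n) (Fin d) (ZMod 2)} (hG : LowBias (α ^ 2 / 2) G)
    {G' : Matrix (Fin n) (Fin d) (ZMod 2)} (hG' : LowCrossBias (α ^ 2 / 2) G' G)
    {u : BinWord d} (hu : u ≠ 0)
    {w : BinWord n} (hw : (hammingNorm w : ℝ) ≤ β * n) :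
    ∑ H, (ldpc n d t r ht (H, G)).toReal
        * (if Rejects (3 / 2 * x) H (G'.mulVec u + w) then 0 else 1)
      ≤ (2 ^ (n * d))⁻¹ * (2 * Real.exp (-(r * x ^ 2))) := by
  have hx0 := h.x_nonneg
  have hα := h.α_pos
  have hβ0 := h.β_nonneg
  have hB : ∑ v, kraw t (G.mulVec v + (G'.mulVec u + w)) ≤ x / 2 := by
    refine le_trans (Finset.sum_le_sum fun v _ => le_abs_self _) (le_trans ?_ h.noise)
    refine sum_abs_kraw_le h.n_pos h.two_le h.two_mul_le h.α_pos h.t_le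
      (M := 2 * β + α ^ 2 / 2) (by positivity) hG (G'.mulVec u + w) Finset.univ fun v _ => ?_
    rw [← add_assoc]
    exact h.abs_bias_le (hG' u hu v) hw
  refine (sum_ldpc_mul_le_exp ht G (G'.mulVec u + w) x (3 * x ^ 2 * r)
    (2 * (2 ^ d * (4 * α) ^ t) + 2 * x ^ 2) _ (fun H => by positivity) (fun H => ?_) ?_).trans ?_
  · split_ifs with hd
    · positivity
    · rw [Rejects, gt_iff_lt, not_lt] at hd
      refine Real.one_le_exp ?_
      rw [signSum_eq]
      nlinarith
  · have h1 := h.sum_kraw_le hG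
    have h2 := cosh_le_one_add_sq hx0 h.x_le
    have h3 := sinh_le_two_mul hx0 h.x_le
    have h4 : (∑ v, kraw t (G.mulVec v + (G'.mulVec u + w))) * Real.sinh x ≤ x / 2 * (2 * x) := by
      have : 0 ≤ Real.sinh x := Real.sinh_nonneg_iff.mpr hx0
      calc _ ≤ x / 2 * Real.sinh x := by gcongr
        _ ≤ _ := by gcongr
    have h5 : (∑ v, kraw t (G.mulVec v)) * Real.cosh x
        ≤ (1 + 2 ^ d * (4 * α) ^ t) * (1 + x ^ 2) :=
      mul_le_mul h1 h2 (Real.cosh_pos x).le (by linarith [h.dev_nonneg])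
    have h6 : x ^ 2 ≤ 1 := by nlinarith [h.x_le]
    nlinarith [h.dev_nonneg]
  · gcongr
    exact h.exp_le
end

/-! ### The robustness game for fixed public keys and answers. -/

theorem PMF.sum_toReal_eq_one {α : Type*} [Fintype α] (p : PMF α) : ∑ a, (p a).toReal = 1 := by
  have h := p.tsum_coe
  rw [tsum_fintype] at h
  rw [← ENNReal.toReal_sum fun a _ => p.apply_ne_top a, h, ENNReal.toReal_one]

theorem PMF.toReal_toOuterMeasure_bind {α β : Type*} [Fintype α] (p : PMF α) (f : α → PMF β)
    (s : Set β) : ((p.bind f).toOuterMeasure s).toReal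
      = ∑ a, (p a).toReal * ((f a).toOuterMeasure s).toReal := by
  have h : ∀ a, (f a).toOuterMeasure s ≠ ⊤ := fun a =>
    ne_top_of_le_ne_top ENNReal.one_ne_top (by
      rw [PMF.toOuterMeasure_apply, ← (f a).tsum_coe]
      exact ENNReal.tsum_le_tsum fun b => Set.indicator_le_self _ _ _)
  rw [PMF.toOuterMeasure_bind_apply, tsum_fintype,
    ENNReal.toReal_sum fun a _ => ENNReal.mul_ne_top (p.apply_ne_top a) (h a)]
  simp only [ENNReal.toReal_mul]

/-- A weighted sum over two independent samples of pairs and a randomized answer that depends only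
on the second components is at most a sum of bounds that hold for every fixed answer. -/
theorem sum_pairs_le {H G Z O : Type*} [Fintype H] [Fintype G] [Fintype Z] [Fintype O]
    (p : H × G → ℝ) (q : Z → ℝ) (a : G → G → Z → O → ℝ) (I : H × G → H × G → Z → O → ℝ)
    (C : G → G → ℝ) (hq : ∀ z, 0 ≤ q z) (hq1 : ∑ z, q z = 1) (ha : ∀ g g' z o, 0 ≤ a g g' z o)
    (ha1 : ∀ g g' z, ∑ o, a g g' z o = 1)
    (hC : ∀ g g' z o, ∑ h, ∑ h', p (h, g) * p (h', g') * I (h, g) (h', g') z o ≤ C g g') :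
    ∑ x, p x * ∑ y, p y * ∑ z, q z * ∑ o, a x.2 y.2 z o * I x y z o ≤ ∑ g, ∑ g', C g g' := by
  have e : ∑ x, p x * ∑ y, p y * ∑ z, q z * ∑ o, a x.2 y.2 z o * I x y z o
      = ∑ g, ∑ g', ∑ z, q z * ∑ o, a g g' z o *
          ∑ h, ∑ h', p (h, g) * p (h', g') * I (h, g) (h', g') z o := by
    rw [Fintype.sum_prod_type_right]
    refine Finset.sum_congr rfl fun g _ => ?_
    simp only [Fintype.sum_prod_type_right, Finset.mul_sum]
    rw [Finset.sum_comm]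
    refine Finset.sum_congr rfl fun g' _ => ?_
    calc ∑ h, ∑ h', ∑ z, ∑ o, p (h, g) * (p (h', g') * (q z * (a g g' z o * I (h, g) (h', g') z o)))
        = ∑ h, ∑ z, ∑ o, ∑ h',
            p (h, g) * (p (h', g') * (q z * (a g g' z o * I (h, g) (h', g') z o))) := by
          refine Finset.sum_congr rfl fun h _ => ?_
          rw [Finset.sum_comm]
          exact Finset.sum_congr rfl fun z _ => Finset.sum_comm
      _ = ∑ z, ∑ o, ∑ h, ∑ h',
            p (h, g) * (p (h', g') * (q z * (a g g' z o * I (h, g) (h', g') z o))) := by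
          rw [Finset.sum_comm]
          exact Finset.sum_congr rfl fun z _ => Finset.sum_comm
      _ = _ := Finset.sum_congr rfl fun z _ => Finset.sum_congr rfl fun o _ =>
          Finset.sum_congr rfl fun h _ => Finset.sum_congr rfl fun h' _ => by ring
  rw [e]
  refine Finset.sum_le_sum fun g _ => Finset.sum_le_sum fun g' _ => ?_
  calc _ ≤ ∑ z, q z * ∑ o, a g g' z o * C g g' := by
        gcongr with z _ o _
        · exact hq z
        · exact ha g g' z o
        · exact hC g g' z o
    _ = C g g' := by
        simp only [← Finset.sum_mul, ha1, one_mul, hq1]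

open Classical in
theorem toReal_toOuterMeasure_game {n d t r : ℕ} (ht : t ≤ n)
    (A : (Bool → Matrix (Fin n) (Fin d) (ZMod 2)) × BinWord n →
      PMF (Bool × (BinWord d × BinWord n) × BinWord n))
    (s : Set ((((Bool → Matrix (Fin r) (Fin n) (ZMod 2)) × BinWord n) ×
      ((Bool → Matrix (Fin n) (Fin d) (ZMod 2)) × BinWord n)) ×
      Bool × (BinWord d × BinWord n) × BinWord n)) :
    ((PMF.bind ((ldpc n d t r ht).bind fun HG₀ =>
      (ldpc n d t r ht).bind fun HG₁ =>
      (PMF.uniformOfFintype (BinWord n)).bind fun z =>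
      PMF.pure ((fun m : Bool => if m then HG₁.1 else HG₀.1, z),
        (fun m : Bool => if m then HG₁.2 else HG₀.2, z)))
        fun keys => (A keys.2).bind fun out => PMF.pure (keys, out)).toOuterMeasure s).toReal
      = ∑ x, (ldpc n d t r ht x).toReal * ∑ y, (ldpc n d t r ht y).toReal *
        ∑ z, (PMF.uniformOfFintype (BinWord n) z).toReal *
        ∑ o, (A (fun m => if m then y.2 else x.2, z) o).toReal *
        (if (((fun m : Bool => if m then y.1 else x.1, z),
            (fun m : Bool => if m then y.2 else x.2, z)), o) ∈ s then 1 else 0) := by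
  simp only [PMF.bind_bind, PMF.pure_bind, PMF.toReal_toOuterMeasure_bind]
  refine Finset.sum_congr rfl fun x _ => ?_
  congr 1
  refine Finset.sum_congr rfl fun y _ => ?_
  congr 1
  refine Finset.sum_congr rfl fun z _ => ?_
  congr 1
  refine Finset.sum_congr rfl fun o _ => ?_
  congr 1
  rw [PMF.toOuterMeasure_pure_apply]
  split_ifs <;> simp

-- The answer is independent of the secret matrices given the public key, so a bound `C` valid for
-- every fixed answer survives averaging over `z` and the adversary's coins. `C` bounds an
-- unnormalized mass, so it is summed over the public matrices rather than averaged.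
open Classical in
theorem ldpcPRC1_winProb_le {n d t r : ℕ} {η ζ δ : ℝ} (hd : 0 < d) (ht : t ≤ n)
    (hη : ⌊η * n⌋₊ ≤ n) (A : (ldpcPRC1 n d t r η ζ hd ht hη).Adversary)
    (C : Matrix (Fin n) (Fin d) (ZMod 2) → Matrix (Fin n) (Fin d) (ZMod 2) → ℝ)
    (hC : ∀ (G₀ G₁ : Matrix (Fin n) (Fin d) (ZMod 2)) (z : BinWord n)
      (o : Bool × (BinWord d × BinWord n) × BinWord n),
      ∑ H₀, ∑ H₁, (ldpc n d t r ht (H₀, G₀)).toReal * (ldpc n d t r ht (H₁, G₁)).toReal *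
        (if (((fun m : Bool => if m then H₁ else H₀, z),
            (fun m : Bool => if m then G₁ else G₀, z)), o) ∈
              (ldpcPRC1 n d t r η ζ hd ht hη).Wins δ then 1 else 0) ≤ C G₀ G₁) :
    (ldpcPRC1 n d t r η ζ hd ht hη).winProb δ A ≤ ∑ G₀, ∑ G₁, C G₀ G₁ := by
  let A' : (Bool → Matrix (Fin n) (Fin d) (ZMod 2)) × BinWord n →
    PMF (Bool × (BinWord d × BinWord n) × BinWord n) := A
  have e : (ldpcPRC1 n d t r η ζ hd ht hη).winProb δ A
      = ∑ x, (ldpc n d t r ht x).toReal * ∑ y, (ldpc n d t r ht y).toReal *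
        ∑ z, (PMF.uniformOfFintype (BinWord n) z).toReal *
        ∑ o, (A' (fun m => if m then y.2 else x.2, z) o).toReal *
        (if (((fun m : Bool => if m then y.1 else x.1, z),
            (fun m : Bool => if m then y.2 else x.2, z)), o) ∈
              (ldpcPRC1 n d t r η ζ hd ht hη).Wins δ then 1 else 0) :=
    toReal_toOuterMeasure_game ht A' _
  rw [e]
  exact sum_pairs_le (fun x => (ldpc n d t r ht x).toReal)
    (fun z => (PMF.uniformOfFintype (BinWord n) z).toReal)
    (fun g g' z o => (A' (fun m => if m then g' else g, z) o).toReal)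
    (fun x y z o => if (((fun m : Bool => if m then y.1 else x.1, z),
            (fun m : Bool => if m then y.2 else x.2, z)), o) ∈
              (ldpcPRC1 n d t r η ζ hd ht hη).Wins δ then 1 else 0) C
    (fun _ => ENNReal.toReal_nonneg) (PMF.sum_toReal_eq_one _)
    (fun _ _ _ _ => ENNReal.toReal_nonneg) (fun _ _ _ => PMF.sum_toReal_eq_one _) hC

open Classical in
/-- If the adversary wins then one of the two detectors errs on a small perturbation of a nonzero
codeword. -/
theorem exists_of_mem_wins {n d t r : ℕ} {η ζ δ β : ℝ} (hd : 0 < d) (ht : t ≤ n)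
    (hη : ⌊η * n⌋₊ ≤ n) (hη0 : 0 ≤ η) (hβ : η + δ ≤ β)
    (H : Bool → Matrix (Fin r) (Fin n) (ZMod 2)) (G : Bool → Matrix (Fin n) (Fin d) (ZMod 2))
    (z : BinWord n) (m : Bool) (u : BinWord d) (e x : BinWord n)
    (h : (((H, z), (G, z)), m, (u, e), x) ∈ (ldpcPRC1 n d t r η ζ hd ht hη).Wins δ) :
    u ≠ 0 ∧ (hammingNorm ((G m).mulVec u + (x + z)) : ℝ) ≤ β * n ∧
      (¬ Detects ζ (H m) (x + z) ∨ ¬ Rejects ζ (H !m) (x + z)) := by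
  obtain ⟨h1, h2, h3⟩ := h
  change (u, e) ∈ ((PMF.uniformOfFinset (Finset.univ.filter fun u : BinWord d => u ≠ 0)
      (nonzero_nonempty hd)).bind fun u =>
    (PMF.uniformOfFinset (sparseVectors ⌊η * n⌋₊ n) (sparseVectors_nonempty hη)).bind fun e =>
    PMF.pure (u, e)).support at h1
  change (hammingDist x ((G m).mulVec u + z + e) : ℝ) ≤ δ * n at h2
  simp only [PMF.mem_support_bind_iff, PMF.mem_support_uniformOfFinset_iff, PMF.support_pure,
    Set.mem_singleton_iff, Prod.mk.injEq, Finset.mem_filter, Finset.mem_univ, true_and,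
    sparseVectors] at h1
  obtain ⟨u', hu', e', he', rfl, rfl⟩ := h1
  refine ⟨hu', ?_, ?_⟩
  · have h4 : (G m).mulVec u + (x + z) = -e + (-x + ((G m).mulVec u + z + e)) := by
      have : ∀ a b c f : ZMod 2, a + (b + c) = -f + (-b + (a + c + f)) := by decide
      exact funext fun i => this _ _ _ _
    have h5 := hammingDist_triangle e 0 (-x + ((G m).mulVec u + z + e))
    rw [hammingDist_zero_right, hammingDist_zero_left, hammingDist_eq_hammingNorm, ← h4] at h5
    rw [hammingDist_eq_hammingNorm] at h2
    have h6 : (hammingNorm e : ℝ) ≤ η * n := by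
      rw [he']
      exact Nat.floor_le (by positivity)
    have h7 : (hammingNorm ((G m).mulVec u + (x + z)) : ℝ)
        ≤ hammingNorm e + hammingNorm (-x + ((G m).mulVec u + z + e)) := by exact_mod_cast h5
    have : (η + δ) * n ≤ β * n := by gcongr
    linarith
  · by_contra! hcon
    obtain ⟨hD, hR⟩ := hcon
    apply h3
    change (if Detects ζ (H false) (x + z) ∧ Rejects ζ (H true) (x + z) then some false
      else if Detects ζ (H true) (x + z) ∧ Rejects ζ (H false) (x + z) then some true
      else none) = some m
    cases m
    · rw [if_pos ⟨hD, hR⟩]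
    -- The decoder tests `false` first; that branch is excluded because `H false` rejects strictly.
    · rw [if_neg, if_pos ⟨hD, hR⟩]
      rintro ⟨hD', -⟩
      exact lt_asymm hD' hR

open Classical in
/-- For fixed public keys of low bias and a fixed answer of the adversary, the decoder fails with
small probability. -/
theorem Reliable.sum_sum_wins_le {n d t r : ℕ} {α β x η δ : ℝ} (h : Reliable n d t r α β x)
    (hd : 0 < d) (ht : t ≤ n) (hη : ⌊η * n⌋₊ ≤ n) (hη0 : 0 ≤ η) (hβ : η + δ ≤ β)
    (G₀ G₁ : Matrix (Fin n) (Fin d) (ZMod 2)) (h₀ : LowBias (α ^ 2 / 2) G₀)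
    (h₁ : LowBias (α ^ 2 / 2) G₁) (h₀₁ : LowCrossBias (α ^ 2 / 2) G₀ G₁)
    (h₁₀ : LowCrossBias (α ^ 2 / 2) G₁ G₀) (z : BinWord n)
    (o : Bool × (BinWord d × BinWord n) × BinWord n) :
    ∑ H₀, ∑ H₁, (ldpc n d t r ht (H₀, G₀)).toReal * (ldpc n d t r ht (H₁, G₁)).toReal *
        (if (((fun m : Bool => if m then H₁ else H₀, z),
            (fun m : Bool => if m then G₁ else G₀, z)), o) ∈
              (ldpcPRC1 n d t r η (3 / 2 * x) hd ht hη).Wins δ then 1 else 0)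
      ≤ ((2 ^ (n * d))⁻¹) ^ 2 * (8 * Real.exp (-(r * x ^ 2))) := by
  obtain ⟨m, ⟨u, e⟩, X⟩ := o
  set q : ℝ := (2 ^ (n * d))⁻¹ with hq
  set E : ℝ := Real.exp (-(r * x ^ 2)) with hE
  have hq0 : 0 ≤ q := by positivity
  have hE0 : 0 ≤ E := by positivity
  -- `P₀` and `P₁` say that the respective detector is correct. In the union bound the untouched
  -- matrix contributes its marginal mass, at most `2 q`, which gives `2 · (2 q)(2 q E) = 8 q² E`.
  have general : ∀ P₀ P₁ : Matrix (Fin r) (Fin n) (ZMod 2) → Prop,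
      ∑ H, (ldpc n d t r ht (H, G₀)).toReal * (if P₀ H then 0 else 1) ≤ q * (2 * E) →
      ∑ H, (ldpc n d t r ht (H, G₁)).toReal * (if P₁ H then 0 else 1) ≤ q * (2 * E) →
      (∀ H₀ H₁, (((fun m : Bool => if m then H₁ else H₀, z),
            (fun m : Bool => if m then G₁ else G₀, z)), m, (u, e), X) ∈
              (ldpcPRC1 n d t r η (3 / 2 * x) hd ht hη).Wins δ → ¬ P₀ H₀ ∨ ¬ P₁ H₁) →
      ∑ H₀, ∑ H₁, (ldpc n d t r ht (H₀, G₀)).toReal * (ldpc n d t r ht (H₁, G₁)).toReal *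
        (if (((fun m : Bool => if m then H₁ else H₀, z),
            (fun m : Bool => if m then G₁ else G₀, z)), m, (u, e), X) ∈
              (ldpcPRC1 n d t r η (3 / 2 * x) hd ht hη).Wins δ then 1 else 0)
        ≤ q ^ 2 * (8 * E) := by
    intro P₀ P₁ b₀ b₁ hP
    have m₀ := h.sum_ldpc_le ht h₀
    have m₁ := h.sum_ldpc_le ht h₁
    calc _ ≤ ∑ H₀, ∑ H₁, (((ldpc n d t r ht (H₀, G₀)).toReal * (if P₀ H₀ then 0 else 1))
            * (ldpc n d t r ht (H₁, G₁)).toReal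
          + (ldpc n d t r ht (H₀, G₀)).toReal
            * ((ldpc n d t r ht (H₁, G₁)).toReal * (if P₁ H₁ then 0 else 1))) := by
          refine Finset.sum_le_sum fun H₀ _ => Finset.sum_le_sum fun H₁ _ => ?_
          have p0 : 0 ≤ (ldpc n d t r ht (H₀, G₀)).toReal := ENNReal.toReal_nonneg
          have p1 : 0 ≤ (ldpc n d t r ht (H₁, G₁)).toReal := ENNReal.toReal_nonneg
          have p2 := mul_nonneg p0 p1
          split_ifs with hw k0 k1 k1 <;> first
            | (exfalso; have := hP H₀ H₁ hw; simp [k0, k1] at this; done)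
            | (simp only [mul_zero, mul_one, zero_mul, add_zero, zero_add]; linarith)
      _ = (∑ H, (ldpc n d t r ht (H, G₀)).toReal * (if P₀ H then 0 else 1))
            * (∑ H, (ldpc n d t r ht (H, G₁)).toReal)
          + (∑ H, (ldpc n d t r ht (H, G₀)).toReal)
            * (∑ H, (ldpc n d t r ht (H, G₁)).toReal * (if P₁ H then 0 else 1)) := by
          simp only [Finset.sum_add_distrib, Finset.sum_mul_sum]
      _ ≤ (q * (2 * E)) * (2 * q) + (2 * q) * (q * (2 * E)) := by
          have s0 : 0 ≤ ∑ H, (ldpc n d t r ht (H, G₁)).toReal :=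
            Finset.sum_nonneg fun _ _ => ENNReal.toReal_nonneg
          have s1 : 0 ≤ ∑ H, (ldpc n d t r ht (H, G₁)).toReal * (if P₁ H then (0 : ℝ) else 1) :=
            Finset.sum_nonneg fun _ _ => mul_nonneg ENNReal.toReal_nonneg (by positivity)
          gcongr
      _ = _ := by ring
  by_cases hgood : u ≠ 0 ∧
      (hammingNorm ((if m then G₁ else G₀).mulVec u + (X + z)) : ℝ) ≤ β * n
  · obtain ⟨hu, hw⟩ := hgood
    cases m
    · simp only [Bool.false_eq_true, if_false] at hw
      have hy : X + z = G₀.mulVec u + (G₀.mulVec u + (X + z)) := by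
        rw [← add_assoc, BinWord.add_self, zero_add]
      refine general (fun H => Detects (3 / 2 * x) H (G₀.mulVec u + (G₀.mulVec u + (X + z))))
        (fun H => Rejects (3 / 2 * x) H (G₀.mulVec u + (G₀.mulVec u + (X + z))))
        (h.sum_not_detects_le ht h₀ u hw) (h.sum_not_rejects_le ht h₁ h₀₁ hu hw) ?_
      intro H₀ H₁ hwin
      have := (exists_of_mem_wins hd ht hη hη0 hβ _ _ z _ u e X hwin).2.2
      rw [← hy]
      simpa using this
    · simp only [if_true] at hw
      have hy : X + z = G₁.mulVec u + (G₁.mulVec u + (X + z)) := by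
        rw [← add_assoc, BinWord.add_self, zero_add]
      refine general (fun H => Rejects (3 / 2 * x) H (G₁.mulVec u + (G₁.mulVec u + (X + z))))
        (fun H => Detects (3 / 2 * x) H (G₁.mulVec u + (G₁.mulVec u + (X + z))))
        (h.sum_not_rejects_le ht h₀ h₁₀ hu hw) (h.sum_not_detects_le ht h₁ u hw) ?_
      intro H₀ H₁ hwin
      have := (exists_of_mem_wins hd ht hη hη0 hβ _ _ z _ u e X hwin).2.2
      rw [← hy]
      simpa [or_comm] using this
  -- An inadmissible answer never wins, whatever the secret matrices.
  · refine general (fun _ => True) (fun _ => True) (by simp; positivity) (by simp; positivity) ?_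
    intro H₀ H₁ hwin
    have := exists_of_mem_wins hd ht hη hη0 hβ _ _ z _ u e X hwin
    exact absurd ⟨this.1, this.2.1⟩ hgood

-- Large bias is charged to the true key distribution. For low-bias pairs with a large cross bias,
-- the mass is at most `4 q²` and is charged to uniform matrices. For the remaining pairs the
-- detectors fail with small mass.
open Classical in
theorem Reliable.winProb_le {n d t r : ℕ} {α β x η δ b₀ l : ℝ} (h : Reliable n d t r α β x)
    (hd : 0 < d) (ht : t ≤ n) (hη : ⌊η * n⌋₊ ≤ n) (hη0 : 0 ≤ η) (hβ : η + δ ≤ β) (hr : r ≤ n)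
    (hμ : 16 * (t : ℝ) ^ 2 ≤ n * (α ^ 2 / 2) ^ 2) (hb₀ : b₀ ^ (t - 2) ≤ 1 / 8) (hl : 0 ≤ l)
    (A : (ldpcPRC1 n d t r η (3 / 2 * x) hd ht hη).Adversary) :
    (ldpcPRC1 n d t r η (3 / 2 * x) hd ht hη).winProb δ A
      ≤ 2 * (2 ^ d * ((n + 1) * (2 * Real.exp (-(n * (α ^ 2 / 2) ^ 2 / 4)))
          + 2 * (2 ^ r * ((Real.exp l + Real.exp (-l)) * Real.exp (-(l * b₀)) / 2) ^ n)))
        + 8 * (2 ^ d * 2 ^ d * (2 * Real.exp (-(n * (α ^ 2 / 2) ^ 2 / 2))))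
        + 8 * Real.exp (-(r * x ^ 2)) := by
  set μ := α ^ 2 / 2 with hμ'
  have hμ0 : 0 ≤ μ := by positivity
  set q : ℝ := (2 ^ (n * d))⁻¹ with hq
  set E : ℝ := Real.exp (-(r * x ^ 2)) with hE
  set S : ℝ := (n + 1) * (2 * Real.exp (-(n * μ ^ 2 / 4)))
          + 2 * (2 ^ r * ((Real.exp l + Real.exp (-l)) * Real.exp (-(l * b₀)) / 2) ^ n) with hS
  have hq0 : 0 ≤ q := by positivity
  have hE0 : 0 ≤ E := by positivity
  let w : Matrix (Fin n) (Fin d) (ZMod 2) → ℝ := fun G => ∑ H, (ldpc n d t r ht (H, G)).toReal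
  have hw0 : ∀ G, 0 ≤ w G := fun G => Finset.sum_nonneg fun _ _ => ENNReal.toReal_nonneg
  have hw1 : ∑ G, w G = 1 := by
    rw [← PMF.sum_toReal_eq_one (ldpc n d t r ht), Fintype.sum_prod_type_right]
  have hbad : ∑ G, w G * (if LowBias μ G then 0 else 1) ≤ 2 ^ d * S := by
    have h1 := sum_ldpc_not_lowBias_le (d := d) (r := r) ht μ
    have h2 := sum_biased_one_add_kraw_le h.n_pos h.two_le h.two_mul_le hr hμ hμ0 hb₀ hl
    rw [Finset.sum_comm] at h1
    simp only [← Finset.sum_mul] at h1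
    refine h1.trans ?_
    gcongr
  have hcross : ∀ G', ∑ G : Matrix (Fin n) (Fin d) (ZMod 2),
      q ^ 2 * (if LowCrossBias μ G G' then (0 : ℝ) else 1)
        ≤ q * (2 ^ d * 2 ^ d * (2 * Real.exp (-(n * μ ^ 2 / 2)))) := by
    intro G'
    have h1 := card_not_lowCrossBias_le h.n_pos hμ0 G'
    have h2 : ∑ G : Matrix (Fin n) (Fin d) (ZMod 2), (if LowCrossBias μ G G' then (0 : ℝ) else 1)
        = (Finset.univ.filter fun G : Matrix (Fin n) (Fin d) (ZMod 2) =>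
            ¬ LowCrossBias μ G G').card := by
      rw [Finset.card_filter]
      push_cast
      exact Finset.sum_congr rfl fun G _ => by split_ifs <;> simp_all
    rw [← Finset.mul_sum, h2]
    calc _ ≤ q ^ 2 * (2 ^ (n * d) * (2 ^ d * 2 ^ d * (2 * Real.exp (-(n * μ ^ 2 / 2))))) := by
          gcongr
      _ = q * (q * 2 ^ (n * d)) * (2 ^ d * 2 ^ d * (2 * Real.exp (-(n * μ ^ 2 / 2)))) := by ring
      _ = _ := by rw [hq, inv_mul_cancel₀ (by positivity), mul_one]
  have hq1 : ∑ _ : Matrix (Fin n) (Fin d) (ZMod 2), q = 1 := by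
    rw [Finset.sum_const, nsmul_eq_mul, Finset.card_univ, card_binMatrix, hq]
    push_cast
    exact mul_inv_cancel₀ (by positivity)
  refine (ldpcPRC1_winProb_le (δ := δ) hd ht hη A (fun G₀ G₁ =>
    w G₀ * w G₁ * ((if LowBias μ G₀ then 0 else 1) + (if LowBias μ G₁ then 0 else 1))
      + 4 * (q ^ 2 * (if LowCrossBias μ G₀ G₁ then 0 else 1)
        + q ^ 2 * (if LowCrossBias μ G₁ G₀ then 0 else 1))
      + q ^ 2 * (8 * E)) ?_).trans ?_
  · intro G₀ G₁ z o
    have triv : ∑ H₀, ∑ H₁, (ldpc n d t r ht (H₀, G₀)).toReal * (ldpc n d t r ht (H₁, G₁)).toReal *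
        (if (((fun m : Bool => if m then H₁ else H₀, z),
            (fun m : Bool => if m then G₁ else G₀, z)), o) ∈
              (ldpcPRC1 n d t r η (3 / 2 * x) hd ht hη).Wins δ then 1 else 0)
        ≤ w G₀ * w G₁ := by
      simp only [w]
      rw [Finset.sum_mul_sum]
      refine Finset.sum_le_sum fun H₀ _ => Finset.sum_le_sum fun H₁ _ => ?_
      refine mul_le_of_le_one_right
        (mul_nonneg ENNReal.toReal_nonneg ENNReal.toReal_nonneg) ?_
      split_ifs <;> norm_num
    have hww := mul_nonneg (hw0 G₀) (hw0 G₁)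
    have hqq : 0 ≤ q ^ 2 := by positivity
    have hqE : 0 ≤ q ^ 2 * (8 * E) := by positivity
    by_cases g₀ : LowBias μ G₀
    · by_cases g₁ : LowBias μ G₁
      · have hww' : w G₀ * w G₁ ≤ 4 * q ^ 2 := by
          calc _ ≤ (2 * q) * (2 * q) :=
                mul_le_mul (h.sum_ldpc_le ht g₀) (h.sum_ldpc_le ht g₁) (hw0 _) (by positivity)
            _ = _ := by ring
        by_cases c₀ : LowCrossBias μ G₀ G₁
        · by_cases c₁ : LowCrossBias μ G₁ G₀
          · refine (h.sum_sum_wins_le hd ht hη hη0 hβ G₀ G₁ g₀ g₁ c₀ c₁ z o).trans ?_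
            simp [g₀, g₁, c₀, c₁, hq, hE]
          · refine triv.trans ?_
            simp only [g₀, g₁, c₀, c₁, if_true, if_false]
            linarith
        · refine triv.trans ?_
          simp only [g₀, g₁, c₀, if_true, if_false]
          split_ifs <;> linarith
      · refine triv.trans ?_
        simp only [g₀, g₁, if_true, if_false]
        split_ifs <;> linarith
    · refine triv.trans ?_
      simp only [g₀, if_false]
      split_ifs <;> linarith
  · simp only [Finset.sum_add_distrib, mul_add]
    have a1 : ∑ G₀, ∑ G₁, w G₀ * w G₁ * (if LowBias μ G₀ then (0 : ℝ) else 1) ≤ 2 ^ d * S := by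
      refine le_trans (le_of_eq ?_) hbad
      refine Finset.sum_congr rfl fun G₀ _ => ?_
      rw [← Finset.sum_mul, ← Finset.mul_sum, hw1, mul_one]
    have a2 : ∑ G₀, ∑ G₁, w G₀ * w G₁ * (if LowBias μ G₁ then (0 : ℝ) else 1) ≤ 2 ^ d * S := by
      refine le_trans (le_of_eq ?_) hbad
      simp only [mul_assoc, ← Finset.mul_sum]
      rw [← Finset.sum_mul, hw1, one_mul]
    have a3 : ∑ G₀ : Matrix (Fin n) (Fin d) (ZMod 2), ∑ G₁ : Matrix (Fin n) (Fin d) (ZMod 2),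
        4 * (q ^ 2 * (if LowCrossBias μ G₀ G₁ then (0 : ℝ) else 1))
        ≤ 4 * (2 ^ d * 2 ^ d * (2 * Real.exp (-(n * μ ^ 2 / 2)))) := by
      rw [Finset.sum_comm]
      simp only [← Finset.mul_sum (a := (4 : ℝ))]
      gcongr
      refine (Finset.sum_le_sum fun G' _ => hcross G').trans ?_
      rw [← Finset.sum_mul, hq1, one_mul]
    have a4 : ∑ G₀ : Matrix (Fin n) (Fin d) (ZMod 2), ∑ G₁ : Matrix (Fin n) (Fin d) (ZMod 2),
        4 * (q ^ 2 * (if LowCrossBias μ G₁ G₀ then (0 : ℝ) else 1))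
        ≤ 4 * (2 ^ d * 2 ^ d * (2 * Real.exp (-(n * μ ^ 2 / 2)))) := by
      simp only [← Finset.mul_sum (a := (4 : ℝ))]
      gcongr
      refine (Finset.sum_le_sum fun G' _ => hcross G').trans ?_
      rw [← Finset.sum_mul, hq1, one_mul]
    have a5 : ∑ _ : Matrix (Fin n) (Fin d) (ZMod 2), ∑ _ : Matrix (Fin n) (Fin d) (ZMod 2),
        q ^ 2 * (8 * E) = 8 * E := by
      have : ∀ c : ℝ, ∑ _ : Matrix (Fin n) (Fin d) (ZMod 2), q * c = c := fun c => by
        rw [← Finset.sum_mul, hq1, one_mul]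
      simp only [sq, mul_assoc, this]
    linarith

/-! ### Asymptotics of the parameters. -/

theorem two_pow_pow_five_le {r t : ℕ} (hr : r ≠ 0) (ht : t = 2 * (Nat.log 2 r / 10)) :
    (2 ^ t) ^ 5 ≤ r ∧ r < (2 ^ t) ^ 5 * 2 ^ 10 := by
  rw [← pow_mul, ← pow_add]
  constructor
  · exact (Nat.pow_le_pow_right (by norm_num) (by omega)).trans (Nat.pow_log_le_self 2 hr)
  · exact (Nat.lt_pow_succ_log_self (by norm_num) r).trans_le
      (Nat.pow_le_pow_right (by norm_num) (by omega))

/-- By the choice of `t`, `5 t ≤ log₂ r < 5 t + 10`; so `2^(-t)` agrees with `r^(-1/5)` up to a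
factor `2 ^ (10 / 5) = 4`. -/
theorem half_pow_bounds {r t : ℕ} (hr : r ≠ 0) (ht : t = 2 * (Nat.log 2 r / 10)) :
    (r : ℝ) ^ (-(1 / 5) : ℝ) ≤ (1 / 2) ^ t ∧ (1 / 2) ^ t ≤ 4 * (r : ℝ) ^ (-(1 / 5) : ℝ) := by
  obtain ⟨h1, h2⟩ := two_pow_pow_five_le hr ht
  have h1 : ((2 : ℝ) ^ t) ^ 5 ≤ r := by exact_mod_cast h1
  have h2 : (r : ℝ) ≤ ((2 : ℝ) ^ t * 4) ^ 5 := by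
    have : (r : ℝ) ≤ ((2 : ℝ) ^ t) ^ 5 * 2 ^ 10 := by exact_mod_cast h2.le
    linarith [show ((2 : ℝ) ^ t * 4) ^ 5 = ((2 : ℝ) ^ t) ^ 5 * 2 ^ 10 by rw [mul_pow]; norm_num]
  have hr0 : (0 : ℝ) < r := by exact_mod_cast Nat.pos_of_ne_zero hr
  have e : ((r : ℝ) ^ (1 / 5 : ℝ)) ^ 5 = r := by
    rw [← Real.rpow_natCast, ← Real.rpow_mul hr0.le]; norm_num
  have hp : 0 < (r : ℝ) ^ (1 / 5 : ℝ) := Real.rpow_pos_of_pos hr0 _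
  have h3 : (2 : ℝ) ^ t ≤ (r : ℝ) ^ (1 / 5 : ℝ) :=
    le_of_pow_le_pow_left₀ (n := 5) (by norm_num) hp.le (by rw [e]; exact h1)
  have h4 : (r : ℝ) ^ (1 / 5 : ℝ) ≤ 2 ^ t * 4 :=
    le_of_pow_le_pow_left₀ (n := 5) (by norm_num) (by positivity) (by rw [e]; exact h2)
  rw [Real.rpow_neg hr0.le, show (1 / 2 : ℝ) ^ t = (2 ^ t)⁻¹ by rw [one_div, inv_pow]]
  refine ⟨inv_anti₀ (by positivity) h3, ?_⟩
  rw [← div_eq_mul_inv, inv_eq_one_div, div_le_div_iff₀ (by positivity) hp]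
  linarith

theorem floor_bounds {t L d : ℕ} (hd : d = ⌊(1 / 20 : ℚ) * t * L⌋₊) :
    20 * d ≤ t * L ∧ t * L < 20 * (d + 1) := by
  have h1 := Nat.floor_le (by positivity : (0 : ℚ) ≤ (1 / 20 : ℚ) * t * L)
  have h2 := Nat.lt_floor_add_one ((1 / 20 : ℚ) * t * L)
  rw [← hd] at h1 h2
  constructor
  · have : (20 * d : ℚ) ≤ t * L := by linarith
    exact_mod_cast this
  · have : (t * L : ℚ) < 20 * (d + 1) := by linarith
    exact_mod_cast this

theorem eventually_const_mul_rpow_le (A : ℝ) {a b : ℝ} (hab : a < b) :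
    ∀ᶠ n : ℕ in atTop, A * (n : ℝ) ^ a ≤ (n : ℝ) ^ b := by
  have h1 : Tendsto (fun n : ℕ => (n : ℝ) ^ (b - a)) atTop atTop :=
    (tendsto_rpow_atTop (by linarith)).comp tendsto_natCast_atTop_atTop
  filter_upwards [h1.eventually_ge_atTop A, eventually_gt_atTop 0] with n hn hn0
  have hn0 : (0 : ℝ) < n := by exact_mod_cast hn0
  calc A * (n : ℝ) ^ a ≤ (n : ℝ) ^ (b - a) * (n : ℝ) ^ a := by gcongr
    _ = _ := by rw [← Real.rpow_add hn0]; congr 1; ring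

theorem natLog_le_two_mul_log (n : ℕ) : (Nat.log 2 n : ℝ) ≤ 2 * Real.log n := by
  rcases Nat.eq_zero_or_pos n with rfl | hn
  · simp
  have h1 : ((2 : ℝ) ^ Nat.log 2 n) ≤ n := by exact_mod_cast Nat.pow_log_le_self 2 hn.ne'
  have h2 := Real.log_le_log (by positivity) h1
  rw [Real.log_pow] at h2
  have := Real.log_two_gt_d9
  have h0 : (0 : ℝ) ≤ Nat.log 2 n := Nat.cast_nonneg _
  nlinarith

theorem log_le_natLog_add_one (n : ℕ) : Real.log n ≤ Nat.log 2 n + 1 := by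
  rcases Nat.eq_zero_or_pos n with rfl | hn
  · simp
  have h1 : (n : ℝ) ≤ 2 ^ (Nat.log 2 n + 1) := by
    exact_mod_cast (Nat.lt_pow_succ_log_self (by norm_num) n).le
  have h2 := Real.log_le_log (by positivity) h1
  rw [Real.log_pow] at h2
  have := Real.log_two_lt_d9
  push_cast at h2
  have h0 : (0 : ℝ) ≤ Nat.log 2 n := Nat.cast_nonneg _
  nlinarith

theorem eventually_natLog_sq_le :
    ∀ᶠ n : ℕ in atTop, (Nat.log 2 n : ℝ) ^ 2 ≤ (n : ℝ) ^ (1 / 100 : ℝ) := by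
  have h1 := (isLittleO_log_rpow_atTop (by norm_num : (0 : ℝ) < 1 / 200)).bound
    (by norm_num : (0 : ℝ) < 1 / 2)
  filter_upwards [tendsto_natCast_atTop_atTop.eventually h1, eventually_ge_atTop 1] with n h hn
  have hn1 : (1 : ℝ) ≤ n := by exact_mod_cast hn
  rw [Real.norm_of_nonneg (Real.log_nonneg hn1), Real.norm_of_nonneg (by positivity)] at h
  have h2 := natLog_le_two_mul_log n
  calc (Nat.log 2 n : ℝ) ^ 2 ≤ ((n : ℝ) ^ (1 / 200 : ℝ)) ^ 2 := by gcongr; linarith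
    _ = _ := by rw [← Real.rpow_natCast, ← Real.rpow_mul (by positivity)]; norm_num

theorem eventually_le_sparsity {b : ℝ} (hb : 0 < b) (T : ℕ) :
    ∀ᶠ n : ℕ in atTop, ∀ r t : ℕ, (n : ℝ) ^ b ≤ r → t = 2 * (Nat.log 2 r / 10) →
      r ≠ 0 ∧ T ≤ t := by
  have h1 : Tendsto (fun n : ℕ => (n : ℝ) ^ b) atTop atTop :=
    (tendsto_rpow_atTop hb).comp tendsto_natCast_atTop_atTop
  filter_upwards [h1.eventually_ge_atTop ((2 : ℝ) ^ (T * 5 + 10))] with n hn r t hr ht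
  have h2 : (2 : ℝ) ^ (T * 5 + 10) ≤ r := hn.trans hr
  have h2 : 2 ^ (T * 5 + 10) ≤ r := by exact_mod_cast h2
  have h0 : r ≠ 0 := by rintro rfl; simp at h2
  refine ⟨h0, ?_⟩
  have h3 := (two_pow_pow_five_le h0 ht).2
  rw [← pow_mul, ← pow_add] at h3
  have := (Nat.pow_lt_pow_iff_right (by norm_num : 1 < 2)).mp (h2.trans_lt h3)
  omega

theorem two_pow_le_rpow_pow {n t d : ℕ} (hn : n ≠ 0) (hd : 20 * d ≤ t * Nat.log 2 n) :
    (2 : ℝ) ^ d ≤ ((n : ℝ) ^ (1 / 20 : ℝ)) ^ t := by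
  have hn0 : (0 : ℝ) < n := by exact_mod_cast Nat.pos_of_ne_zero hn
  refine le_of_pow_le_pow_left₀ (n := 20) (by norm_num) (by positivity) ?_
  have e : (((n : ℝ) ^ (1 / 20 : ℝ)) ^ t) ^ 20 = (n : ℝ) ^ t := by
    rw [← pow_mul, mul_comm, pow_mul, ← Real.rpow_natCast _ 20, ← Real.rpow_mul hn0.le]
    norm_num
  rw [e, ← pow_mul]
  have h1 : 2 ^ (d * 20) ≤ n ^ t := by
    calc 2 ^ (d * 20) ≤ 2 ^ (Nat.log 2 n * t) :=
          Nat.pow_le_pow_right (by norm_num) (by linarith)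
      _ = (2 ^ Nat.log 2 n) ^ t := pow_mul _ _ _
      _ ≤ n ^ t := Nat.pow_le_pow_left (Nat.pow_log_le_self 2 hn) _
  exact_mod_cast h1

/-- The reason for `ε = 1/20`: then `2 ^ d ≤ n ^ (t / 20)`, half of the gain `n ^ (t / 10)` from `α
= n ^ (-1/10)`. Half of what is left absorbs `4 ^ t`, and `t ≥ 80` turns `n ^ (-t / 40)` into `n ^
(-2)`. -/
theorem eventually_two_pow_mul_pow_le :
    ∀ᶠ n : ℕ in atTop, ∀ t d : ℕ, 80 ≤ t → 20 * d ≤ t * Nat.log 2 n →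
      2 ^ d * (4 * (n : ℝ) ^ (-(1 / 10) : ℝ)) ^ t ≤ (n : ℝ) ^ (-2 : ℝ) := by
  filter_upwards [eventually_const_mul_rpow_le 4 (by norm_num : (-(1 / 20) : ℝ) < -(1 / 40)),
    eventually_ge_atTop 1] with n h4 hn t d ht hd
  have hn1 : (1 : ℝ) ≤ n := by exact_mod_cast hn
  have hn0 : (0 : ℝ) < n := by linarith
  have h1 := two_pow_le_rpow_pow (by omega) hd
  have e : (n : ℝ) ^ (1 / 20 : ℝ) * (4 * (n : ℝ) ^ (-(1 / 10) : ℝ))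
      = 4 * (n : ℝ) ^ (-(1 / 20) : ℝ) := by
    rw [mul_left_comm, ← Real.rpow_add hn0]; norm_num
  calc 2 ^ d * (4 * (n : ℝ) ^ (-(1 / 10) : ℝ)) ^ t
      ≤ ((n : ℝ) ^ (1 / 20 : ℝ)) ^ t * (4 * (n : ℝ) ^ (-(1 / 10) : ℝ)) ^ t := by gcongr
    _ = (4 * (n : ℝ) ^ (-(1 / 20) : ℝ)) ^ t := by rw [← mul_pow, e]
    _ ≤ ((n : ℝ) ^ (-(1 / 40) : ℝ)) ^ t := by gcongr
    _ ≤ ((n : ℝ) ^ (-(1 / 40) : ℝ)) ^ 80 :=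
        pow_le_pow_of_le_one (by positivity)
          (Real.rpow_le_one_of_one_le_of_nonpos hn1 (by norm_num)) ht
    _ = _ := by rw [← Real.rpow_natCast, ← Real.rpow_mul hn0.le]; norm_num

theorem eventually_reliable {b γ : ℝ} (hb : 0 < b) (hγ : 0 < γ) (hγ' : γ ≤ 1 / 4) :
    ∀ᶠ n : ℕ in atTop, ∀ r t d : ℕ, (n : ℝ) ^ b ≤ r → r ≤ n → t = 2 * (Nat.log 2 r / 10) →
      d = ⌊(1 / 20 : ℚ) * t * Nat.log 2 n⌋₊ →
      Reliable n d t r ((n : ℝ) ^ (-(1 / 10) : ℝ)) (1 / 4 - γ) ((r : ℝ) ^ (-(1 / 5) : ℝ)) := by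
  have hdecay : Tendsto (fun t : ℕ => (1 - 2 * γ) ^ t) atTop (nhds 0) :=
    tendsto_pow_atTop_nhds_zero_of_lt_one (by linarith) (by linarith)
  have hgrow : Tendsto (fun t : ℕ => (1 + 4 * γ) ^ t) atTop atTop :=
    tendsto_pow_atTop_atTop_of_one_lt (by linarith)
  -- The bases `1/2 - γ` and `1/2 + 2γ` are `1/2` times `1 - 2γ` and `1 + 4γ`. The constant `1/1000`
  -- makes `2 · 16 · 4 / 1000` less than `1/6` in the noise; 7 is the required 6 plus 1 for the
  -- error `2 t² / n ≤ x`.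
  obtain ⟨T, hT⟩ := eventually_atTop.mp ((hdecay.eventually_le_const
    (by norm_num : (0 : ℝ) < 1 / 1000)).and (hgrow.eventually_ge_atTop 7))
  have hsmall : ∀ᶠ n : ℕ in atTop, (n : ℝ) ^ (-(1 / 5) : ℝ) ≤ 2 * γ := by
    have : Tendsto (fun n : ℕ => (n : ℝ) ^ (-(1 / 5) : ℝ)) atTop (nhds 0) :=
      (tendsto_rpow_neg_atTop (by norm_num : (0 : ℝ) < 1 / 5)).comp tendsto_natCast_atTop_atTop
    exact this.eventually_le_const (by linarith)
  filter_upwards [eventually_le_sparsity hb (max T 80), hsmall, eventually_natLog_sq_le,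
    eventually_two_pow_mul_pow_le, eventually_ge_atTop 4,
    eventually_const_mul_rpow_le 24 (by norm_num : (1 / 100 - 4 / 5 : ℝ) < -(1 / 5)),
    eventually_const_mul_rpow_le 6 (by norm_num : (-2 : ℝ) < -(1 / 5)),
    eventually_const_mul_rpow_le 2 (by norm_num : (1 / 100 - 1 : ℝ) < -(1 / 5)),
    eventually_const_mul_rpow_le 1 (by norm_num : (1 / 100 : ℝ) < 4 / 5),
    eventually_const_mul_rpow_le 2 (by norm_num : (1 / 100 : ℝ) < 1)]
    with n ht hα2 hL hdev hn4 hc1 hc2 hc3 hc4 hc5 r t d hrb hrn htr hd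
  obtain ⟨hr0, htT⟩ := ht r t hrb htr
  obtain ⟨hdecay, hgrow⟩ := hT t ((le_max_left _ _).trans htT)
  have ht80 : 80 ≤ t := (le_max_right _ _).trans htT
  obtain ⟨hx1, hx2⟩ := half_pow_bounds hr0 htr
  have hdev := hdev t d ht80 (floor_bounds hd).1
  have hn4' : (4 : ℝ) ≤ n := by exact_mod_cast hn4
  have hn0 : (0 : ℝ) < n := by linarith
  have hr1 : (1 : ℝ) ≤ r := by exact_mod_cast Nat.one_le_iff_ne_zero.mpr hr0
  have hrn' : (r : ℝ) ≤ n := by exact_mod_cast hrn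
  set x := (r : ℝ) ^ (-(1 / 5) : ℝ) with hx
  set α := (n : ℝ) ^ (-(1 / 10) : ℝ) with hα
  have hxn : (n : ℝ) ^ (-(1 / 5) : ℝ) ≤ x :=
    Real.rpow_le_rpow_of_nonpos (by linarith) hrn' (by norm_num)
  have hx0 : 0 < x := Real.rpow_pos_of_pos (by linarith) _
  have hα0 : 0 < α := Real.rpow_pos_of_pos hn0 _
  have eα : α ^ 2 = (n : ℝ) ^ (-(1 / 5) : ℝ) := by
    rw [hα, ← Real.rpow_natCast, ← Real.rpow_mul hn0.le]; norm_num
  have enα : n * α ^ 2 = (n : ℝ) ^ (4 / 5 : ℝ) := by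
    rw [eα]; nth_rw 1 [← Real.rpow_one (n : ℝ)]; rw [← Real.rpow_add hn0]; norm_num
  have htL : t ≤ Nat.log 2 n := by
    have := Nat.log_mono_right (b := 2) hrn
    omega
  have htL' : (t : ℝ) ≤ Nat.log 2 n := by exact_mod_cast htL
  have ht2 : (t : ℝ) ^ 2 ≤ (n : ℝ) ^ (1 / 100 : ℝ) := le_trans (by gcongr) hL
  have ht1 : (1 : ℝ) ≤ t := by exact_mod_cast (by omega : 1 ≤ t)
  have htt : (t : ℝ) ≤ (n : ℝ) ^ (1 / 100 : ℝ) := by nlinarith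
  have e3 : 2 * (t : ℝ) ^ 2 / n ≤ x := by
    refine le_trans ?_ (hc3.trans hxn)
    rw [Real.rpow_sub hn0, Real.rpow_one, ← mul_div_assoc]
    gcongr
  refine
    { n_pos := by omega
      two_le := by omega
      two_mul_le := ?_
      α_pos := hα0
      α_le := Real.rpow_le_one_of_one_le_of_nonpos (by linarith) (by norm_num)
      t_le := by rw [enα]; linarith
      β_nonneg := by linarith
      β_le := by linarith
      x_nonneg := hx0.le
      x_le := Real.rpow_le_one_of_one_le_of_nonpos hr1 (by norm_num)
      deviation := ?_
      noise := ?_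
      signal := ?_ }
  · rw [Real.rpow_one] at hc5
    have : (2 * t : ℝ) ≤ n := by linarith
    exact_mod_cast this
  · calc r * (2 ^ d * (4 * α) ^ t) ≤ n * (n : ℝ) ^ (-2 : ℝ) := by gcongr
      _ = (n : ℝ)⁻¹ := by
        nth_rw 1 [← Real.rpow_one (n : ℝ)]
        rw [← Real.rpow_add hn0, ← Real.rpow_neg_one]; norm_num
      _ ≤ (4 : ℝ)⁻¹ := inv_anti₀ (by norm_num) hn4'
      _ = 1 / 4 := by norm_num
  · have a1 : 2 * (2 * (1 / 4 - γ) + α ^ 2 / 2) ^ (t - 2) ≤ x / 6 := by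
      have b1 : 2 * (1 / 4 - γ) + α ^ 2 / 2 ≤ 1 / 2 - γ := by rw [eα]; linarith
      -- The two missing factors are each at least `1/4`, because `γ ≤ 1/4`.
      have b2 : (1 / 2 - γ) ^ (t - 2) * (1 / 4) ^ 2 ≤ (1 / 2 - γ) ^ t := by
        have : t = t - 2 + 2 := by omega
        nth_rw 2 [this]
        rw [pow_add]
        have : 0 ≤ 1 / 2 - γ := by linarith
        gcongr
        linarith
      have b3 : (1 / 2 - γ) ^ t = (1 / 2) ^ t * (1 - 2 * γ) ^ t := by
        rw [← mul_pow]; congr 1; ring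
      have b4 : (1 / 2 - γ) ^ t ≤ 4 * x * (1 / 1000) := by
        rw [b3]
        have : 0 ≤ (1 - 2 * γ) ^ t := pow_nonneg (by linarith) t
        gcongr
      have b5 : (2 * (1 / 4 - γ) + α ^ 2 / 2) ^ (t - 2) ≤ (1 / 2 - γ) ^ (t - 2) := by
        have : 0 ≤ 2 * (1 / 4 - γ) + α ^ 2 / 2 := by
          have : 0 ≤ α ^ 2 / 2 := by positivity
          linarith
        gcongr
      linarith
    have a2 : 2 / α ^ 2 * (2 * (t : ℝ) ^ 2 / n) ≤ x / 6 := by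
      have b1 : 2 / α ^ 2 * (2 * (t : ℝ) ^ 2 / n) = 4 * (t : ℝ) ^ 2 / (n : ℝ) ^ (4 / 5 : ℝ) := by
        rw [← enα]; field_simp; norm_num
      have b2 : 24 * (t : ℝ) ^ 2 / (n : ℝ) ^ (4 / 5 : ℝ) ≤ x := by
        refine le_trans ?_ (hc1.trans hxn)
        rw [Real.rpow_sub hn0, ← mul_div_assoc]
        gcongr
      rw [b1]
      rw [mul_div_assoc] at b2 ⊢
      linarith
    have a3 : 2 ^ d * (4 * α) ^ t ≤ x / 6 := by linarith
    linarith
  · have b1 : (1 - 2 * (1 / 4 - γ)) ^ t = (1 / 2) ^ t * (1 + 4 * γ) ^ t := by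
      rw [← mul_pow]; congr 1; ring
    have b2 : x * 7 ≤ (1 / 2) ^ t * (1 + 4 * γ) ^ t := by gcongr
    rw [b1]
    linarith

theorem eventually_failure_le {b κ l b₀ : ℝ} (hκ : κ < 1)
    (hl : (Real.exp l + Real.exp (-l)) * Real.exp (-(l * b₀)) ≤ (2 : ℝ) ^ ((1 - κ) / 2)) :
    ∀ᶠ n : ℕ in atTop, ∀ r t d : ℕ, (n : ℝ) ^ b ≤ r → r ≤ n → (r : ℝ) ≤ κ * n →
      t = 2 * (Nat.log 2 r / 10) → d = ⌊(1 / 20 : ℚ) * t * Nat.log 2 n⌋₊ →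
      2 * (2 ^ d * ((n + 1) * (2 * Real.exp (-(n * (((n : ℝ) ^ (-(1 / 10) : ℝ)) ^ 2 / 2) ^ 2 / 4)))
          + 2 * (2 ^ r * ((Real.exp l + Real.exp (-l)) * Real.exp (-(l * b₀)) / 2) ^ n)))
        + 8 * (2 ^ d * 2 ^ d *
          (2 * Real.exp (-(n * (((n : ℝ) ^ (-(1 / 10) : ℝ)) ^ 2 / 2) ^ 2 / 2))))
        + 8 * Real.exp (-(r * ((r : ℝ) ^ (-(1 / 5) : ℝ)) ^ 2))
      ≤ 16 * Real.exp (-((n : ℝ) ^ min (3 / 5 * b) (1 / 2))) := by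
  set c₁ := Real.log 2 * ((1 - κ) / 2) with hc₁
  have hc₁0 : 0 < c₁ := mul_pos (Real.log_pos (by norm_num)) (by linarith)
  filter_upwards [eventually_natLog_sq_le, eventually_ge_atTop 4,
    eventually_const_mul_rpow_le 3 (by norm_num : (0 : ℝ) < 1 / 100),
    eventually_const_mul_rpow_le (5 * 32) (by norm_num : (1 / 100 : ℝ) < 3 / 5),
    eventually_const_mul_rpow_le 32 (by norm_num : (1 / 2 : ℝ) < 3 / 5),
    eventually_const_mul_rpow_le (2 / c₁ * 2) (by norm_num : (1 / 100 : ℝ) < 1),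
    eventually_const_mul_rpow_le (1 / c₁ * 2) (by norm_num : (1 / 2 : ℝ) < 1)]
    with n hL hn4 hs3 hs hp hs' hp' r t d hrb hrn hrκ htr hd
  have hn4' : (4 : ℝ) ≤ n := by exact_mod_cast hn4
  have hn0 : (0 : ℝ) < n := by linarith
  have hr0 : r ≠ 0 := by
    rintro rfl
    have := Real.rpow_pos_of_pos hn0 b
    simp at hrb
    linarith
  have hr0' : (0 : ℝ) < r := by exact_mod_cast Nat.pos_of_ne_zero hr0
  set s := (n : ℝ) ^ (1 / 100 : ℝ) with hs_def
  set p := (n : ℝ) ^ (1 / 2 : ℝ) with hp_def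
  set N := (n : ℝ) ^ (3 / 5 : ℝ) with hN
  rw [Real.rpow_zero, mul_one] at hs3
  rw [Real.rpow_one] at hs' hp'
  set L := Nat.log 2 n with hL_def
  have hL1 : 1 ≤ L := by
    rw [hL_def]
    exact (Nat.log_pos (by norm_num) (by omega))
  have hL1' : (1 : ℝ) ≤ L := by exact_mod_cast hL1
  have htL : t ≤ L := by
    have := Nat.log_mono_right (b := 2) hrn
    omega
  have two_le_exp : (2 : ℝ) ≤ Real.exp 1 := by linarith [Real.exp_one_gt_d9]
  have h2d : (2 : ℝ) ^ d ≤ Real.exp s := by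
    have h1 : d ≤ L ^ 2 := by
      have := (floor_bounds hd).1
      have : t * L ≤ L * L := Nat.mul_le_mul_right _ htL
      nlinarith
    calc (2 : ℝ) ^ d ≤ Real.exp 1 ^ d := by gcongr
      _ = Real.exp d := by rw [← Real.exp_nat_mul, mul_one]
      _ ≤ _ := by
        rw [Real.exp_le_exp]
        have : (d : ℝ) ≤ (L : ℝ) ^ 2 := by exact_mod_cast h1
        linarith
  have hnexp : (n : ℝ) + 1 ≤ Real.exp (2 * s) := by
    have h1 : n + 1 ≤ 2 ^ (L + 1) := Nat.lt_pow_succ_log_self (by norm_num) n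
    calc (n : ℝ) + 1 ≤ 2 ^ (L + 1) := by exact_mod_cast h1
      _ ≤ Real.exp 1 ^ (L + 1) := by gcongr
      _ = Real.exp (L + 1) := by rw [← Real.exp_nat_mul, mul_one]; push_cast; rfl
      _ ≤ _ := by
        rw [Real.exp_le_exp]
        nlinarith
  have h16 : (16 : ℝ) ≤ Real.exp s := by
    calc (16 : ℝ) ≤ Real.exp 1 ^ 3 := by
          have := Real.exp_one_gt_d9
          calc (16 : ℝ) ≤ 2.7 ^ 3 := by norm_num
            _ ≤ _ := by gcongr; linarith
      _ = Real.exp 3 := by rw [← Real.exp_nat_mul]; norm_num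
      _ ≤ _ := Real.exp_le_exp.mpr hs3
  -- The Hoeffding exponents have order `n μ² ≍ n^(3/5)`, far above `d` and `log n`, which are at
  -- most of order `n^(1/100)`.
  have eN : n * (((n : ℝ) ^ (-(1 / 10) : ℝ)) ^ 2 / 2) ^ 2 = N / 4 := by
    have : (n : ℝ) * (((n : ℝ) ^ (-(1 / 10) : ℝ)) ^ 2) ^ 2 = N := by
      rw [← pow_mul, ← Real.rpow_natCast, ← Real.rpow_mul hn0.le]
      nth_rw 1 [← Real.rpow_one (n : ℝ)]
      rw [← Real.rpow_add hn0, hN]; norm_num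
    rw [div_pow, ← this]; ring
  set Q := Real.exp (-((n : ℝ) ^ min (3 / 5 * b) (1 / 2))) with hQ
  have hpQ : Real.exp (-p) ≤ Q := by
    rw [hQ, Real.exp_le_exp]
    exact neg_le_neg (Real.rpow_le_rpow_of_exponent_le (by linarith) (min_le_right _ _))
  have T1 : 2 * (2 ^ d * ((n + 1) * (2 * Real.exp (-(N / 4 / 4))))) ≤ Q := by
    refine le_trans ?_ hpQ
    calc 2 * (2 ^ d * ((n + 1) * (2 * Real.exp (-(N / 4 / 4)))))
        = 4 * 2 ^ d * (n + 1) * Real.exp (-(N / 4 / 4)) := by ring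
      _ ≤ Real.exp s * Real.exp s * Real.exp (2 * s) * Real.exp (-(N / 4 / 4)) := by
        gcongr; linarith
      _ = Real.exp (4 * s - N / 16) := by
        rw [← Real.exp_add, ← Real.exp_add, ← Real.exp_add]; congr 1; ring
      _ ≤ _ := by rw [Real.exp_le_exp]; linarith
  have T3 : 8 * (2 ^ d * 2 ^ d * (2 * Real.exp (-(N / 4 / 2)))) ≤ Q := by
    refine le_trans ?_ hpQ
    calc 8 * (2 ^ d * 2 ^ d * (2 * Real.exp (-(N / 4 / 2))))
        = 16 * 2 ^ d * 2 ^ d * Real.exp (-(N / 4 / 2)) := by ring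
      _ ≤ Real.exp s * Real.exp s * Real.exp s * Real.exp (-(N / 4 / 2)) := by
        gcongr
      _ = Real.exp (3 * s - N / 8) := by
        rw [← Real.exp_add, ← Real.exp_add, ← Real.exp_add]; congr 1; ring
      _ ≤ _ := by rw [Real.exp_le_exp]; linarith
  -- With `r ≤ κ n`, the exponent of 2 is at most `n (κ - 1 + (1 - κ) / 2) = -n (1 - κ) / 2`.
  have hgeom : (2 : ℝ) ^ r * ((Real.exp l + Real.exp (-l)) * Real.exp (-(l * b₀)) / 2) ^ n
      ≤ Real.exp (-(c₁ * n)) := by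
    have h2 : (2 : ℝ) = Real.exp (Real.log 2) := (Real.exp_log (by norm_num)).symm
    have h3 : (Real.exp l + Real.exp (-l)) * Real.exp (-(l * b₀)) / 2
        ≤ Real.exp (c₁ - Real.log 2) := by
      rw [Real.exp_sub, Real.exp_log (by norm_num), hc₁, ← Real.rpow_def_of_pos (by norm_num)]
      gcongr
    calc _ ≤ Real.exp (Real.log 2) ^ r * Real.exp (c₁ - Real.log 2) ^ n := by
          rw [← h2]; gcongr
      _ = Real.exp (r * Real.log 2 + n * (c₁ - Real.log 2)) := by
          rw [← Real.exp_nat_mul, ← Real.exp_nat_mul, ← Real.exp_add]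
      _ ≤ _ := by
          rw [Real.exp_le_exp]
          have h4 : r * Real.log 2 ≤ κ * n * Real.log 2 := by
            have := Real.log_pos (by norm_num : (1 : ℝ) < 2)
            gcongr
          have h5 : κ * n * Real.log 2 + n * (c₁ - Real.log 2) = -(c₁ * n) := by
            rw [hc₁]; ring
          linarith
  have T2 : 2 * (2 ^ d * (2 * (2 ^ r
      * ((Real.exp l + Real.exp (-l)) * Real.exp (-(l * b₀)) / 2) ^ n))) ≤ Q := by
    refine le_trans ?_ hpQ
    calc _ = 4 * 2 ^ d * (2 ^ r
          * ((Real.exp l + Real.exp (-l)) * Real.exp (-(l * b₀)) / 2) ^ n) := by ring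
      _ ≤ Real.exp s * Real.exp s * Real.exp (-(c₁ * n)) := by
        gcongr; linarith
      _ = Real.exp (2 * s - c₁ * n) := by
        rw [← Real.exp_add, ← Real.exp_add]; congr 1; ring
      _ ≤ _ := by
        rw [Real.exp_le_exp]
        have a1 : 2 * s ≤ c₁ * n / 2 := by
          have := mul_le_mul_of_nonneg_left hs' hc₁0.le
          have e : c₁ * (2 / c₁ * 2 * s) = 4 * s := by field_simp; norm_num
          linarith
        have a2 : p ≤ c₁ * n / 2 := by
          have := mul_le_mul_of_nonneg_left hp' hc₁0.le
          have e : c₁ * (1 / c₁ * 2 * p) = 2 * p := by field_simp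
          linarith
        linarith
  have T4 : 8 * Real.exp (-(r * ((r : ℝ) ^ (-(1 / 5) : ℝ)) ^ 2)) ≤ 8 * Q := by
    gcongr
    rw [hQ, Real.exp_le_exp]
    refine neg_le_neg ?_
    have e : (r : ℝ) * ((r : ℝ) ^ (-(1 / 5) : ℝ)) ^ 2 = (r : ℝ) ^ (3 / 5 : ℝ) := by
      rw [← Real.rpow_natCast, ← Real.rpow_mul hr0'.le]
      nth_rw 1 [← Real.rpow_one (r : ℝ)]
      rw [← Real.rpow_add hr0']; norm_num
    rw [e]
    calc (n : ℝ) ^ min (3 / 5 * b) (1 / 2) ≤ (n : ℝ) ^ (3 / 5 * b) :=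
          Real.rpow_le_rpow_of_exponent_le (by linarith) (min_le_left _ _)
      _ = ((n : ℝ) ^ b) ^ (3 / 5 : ℝ) := by rw [← Real.rpow_mul hn0.le, mul_comm]
      _ ≤ _ := by gcongr
  rw [eN]
  have hQ0 : 0 ≤ Q := (Real.exp_pos _).le
  linarith

theorem superpolynomialDecay_exp_neg_rpow {s : ℝ} (hs : 0 < s) :
    SuperpolynomialDecay atTop (fun k : ℕ => (k : ℝ)) fun k => Real.exp (-((k : ℝ) ^ s)) := by
  intro m
  have h1 := isLittleO_exp_neg_mul_rpow_atTop (zero_lt_one' ℝ) (-((m : ℝ) / s))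
  have h2 : Tendsto (fun k : ℕ => (k : ℝ) ^ s) atTop atTop :=
    (tendsto_rpow_atTop hs).comp tendsto_natCast_atTop_atTop
  have h3 := (h1.comp_tendsto h2).tendsto_div_nhds_zero
  refine h3.congr' ?_
  filter_upwards [eventually_gt_atTop 0] with k hk
  have hk0 : (0 : ℝ) < k := by exact_mod_cast hk
  simp only [Function.comp]
  rw [← Real.rpow_mul hk0.le, mul_neg, mul_div_cancel₀ _ hs.ne', Real.rpow_neg hk0.le,
    Real.rpow_natCast, div_inv_eq_mul, mul_comm, neg_one_mul]

end

/-! ### Choice of parameters and conclusion. -/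

theorem theorem2 (δ : ℝ) (hδ : δ < 1 / 4) (n r : ℕ → ℕ)
    (hn : ∃ a : ℝ, 0 < a ∧ ∀ᶠ k : ℕ in atTop, (k : ℝ) ^ a ≤ n k)
    (hr : ∃ b : ℝ, 0 < b ∧ ∀ᶠ k : ℕ in atTop, (n k : ℝ) ^ b ≤ r k)
    (hr' : ∃ κ : ℝ, κ < 1 ∧ ∀ᶠ k : ℕ in atTop, (r k : ℝ) ≤ κ * n k) :
    ∃ (η : ℚ) (t d : ℕ → ℕ) (_ : 0 < η) (_ : η < 1 / 2) (hη : (η : ℝ) ≤ 1)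
      (ht : ∀ k, t k ≤ n k) (hd : ∀ k, 0 < d k),
      ((fun k => (t k : ℝ)) =Θ[atTop] fun k => Real.log (n k)) ∧
      ((fun k => Real.log (n k) ^ 2) =O[atTop] fun k => (d k : ℝ)) ∧
      -- explicit parameters, efficiently computable from `n` and `r`
      (∀ᶠ k in atTop, t k = 2 * (Nat.log 2 (r k) / 10)) ∧
      (∃ ε : ℚ, 0 < ε ∧ ∀ᶠ k in atTop, d k = ⌊ε * t k * Nat.log 2 (n k)⌋₊) ∧
      AdaptivelyRobust δ fun k =>
        ldpcPRC1 (n k) (d k) (t k) (r k) η (3 / 2 * (r k : ℝ) ^ (-(1 / 5) : ℝ))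
          (hd k) (ht k) (floor_mul_le_of_le_one hη (n k)) := by
  obtain ⟨a, ha, hna⟩ := hn
  obtain ⟨b, hb, hrb⟩ := hr
  obtain ⟨κ, hκ, hrκ⟩ := hr'
  -- `δ` may be negative; the maximum with 0 keeps `η < 1/4` and `γ ≤ 1/4`, so that `β = 1/4 - γ` is
  -- nonnegative.
  have hpos : 0 < 1 / 4 - max δ 0 := by
    rcases max_cases δ 0 with h | h <;> linarith
  obtain ⟨η, hη0, hη1⟩ := exists_rat_btwn hpos
  have hη0' : 0 < η := by exact_mod_cast hη0
  have hδ0 : 0 ≤ max δ 0 := le_max_right _ _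
  have hη4 : (η : ℝ) < 1 / 4 := by linarith
  have hη2 : η < 1 / 2 := by
    have : (η : ℝ) < (1 / 2 : ℚ) := by push_cast; linarith
    exact_mod_cast this
  set γ : ℝ := 1 / 4 - max δ 0 - η with hγ
  have hγ0 : 0 < γ := by linarith
  have hγ4 : γ ≤ 1 / 4 := by linarith
  have hβ : (η : ℝ) + δ ≤ 1 / 4 - γ := by linarith [le_max_left δ 0]
  have hn_top : Tendsto n atTop atTop := by
    have h1 : Tendsto (fun k : ℕ => (k : ℝ) ^ a) atTop atTop :=
      (tendsto_rpow_atTop ha).comp tendsto_natCast_atTop_atTop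
    exact tendsto_natCast_atTop_iff.mp (tendsto_atTop_mono' _ hna h1)
  set τ : ℕ → ℕ := fun k => 2 * (Nat.log 2 (r k) / 10) with hτ
  set D : ℕ → ℕ := fun k => ⌊(1 / 20 : ℚ) * τ k * Nat.log 2 (n k)⌋₊ with hD
  have hrn : ∀ᶠ k in atTop, r k ≤ n k := by
    filter_upwards [hrκ] with k hk
    have h0 : (0 : ℝ) ≤ n k := Nat.cast_nonneg _
    have : (r k : ℝ) ≤ n k := by nlinarith
    exact_mod_cast this
  have hτn : ∀ᶠ k in atTop, τ k ≤ Nat.log 2 (n k) := by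
    filter_upwards [hrn] with k hk
    have := Nat.log_mono_right (b := 2) hk
    simp only [hτ]
    omega
  have hτ80 : ∀ᶠ k in atTop, r k ≠ 0 ∧ 80 ≤ τ k := by
    filter_upwards [hn_top.eventually (eventually_le_sparsity hb 80), hrb] with k h1 h2
    exact h1 (r k) (τ k) h2 rfl
  have hDpos : ∀ᶠ k in atTop, 0 < D k ∧ τ k * Nat.log 2 (n k) ≤ 40 * D k := by
    filter_upwards [hτn, hτ80] with k h1 h2
    have h3 := (floor_bounds (rfl : D k = ⌊(1 / 20 : ℚ) * τ k * Nat.log 2 (n k)⌋₊)).2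
    have h4 : 80 * 80 ≤ τ k * Nat.log 2 (n k) := Nat.mul_le_mul h2.2 (h2.2.trans h1)
    constructor <;> omega
  -- The scheme must be defined for every `k`; the defaults 0 and 1 are used for finitely many `k`
  -- only.
  let t : ℕ → ℕ := fun k => if τ k ≤ n k then τ k else 0
  let d : ℕ → ℕ := fun k => if 0 < D k then D k else 1
  have ht : ∀ k, t k ≤ n k := by
    intro k
    simp only [t]
    split_ifs with h
    · exact h
    · exact Nat.zero_le _
  have hd : ∀ k, 0 < d k := by
    intro k
    simp only [d]
    split_ifs with h
    · exact h
    · exact one_pos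
  have htτ : ∀ᶠ k in atTop, t k = τ k := by
    filter_upwards [hτn] with k h1
    exact if_pos (h1.trans (Nat.log_le_self 2 (n k)))
  have hdD : ∀ᶠ k in atTop, d k = D k := by
    filter_upwards [hDpos] with k h1
    exact if_pos h1.1
  have hlogt : ∀ᶠ k in atTop, 0 ≤ Real.log (n k) ∧ (t k : ℝ) ≤ 2 * Real.log (n k) ∧
      Real.log (n k) ≤ 10 / b * t k := by
    filter_upwards [htτ, hτn, hτ80, hrb, hn_top.eventually_ge_atTop 1] with k h1 h2 h3 h4 h5
    have h5' : (1 : ℝ) ≤ n k := by exact_mod_cast h5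
    refine ⟨Real.log_nonneg h5', ?_, ?_⟩
    · rw [h1]
      have : (τ k : ℝ) ≤ Nat.log 2 (n k) := by exact_mod_cast h2
      linarith [natLog_le_two_mul_log (n k)]
    · rw [h1]
      have h6 := Real.log_le_log (by positivity) h4
      rw [Real.log_rpow (by linarith)] at h6
      have h7 := log_le_natLog_add_one (r k)
      have h8 : Nat.log 2 (r k) + 1 ≤ 10 * τ k := by
        have := h3.2
        simp only [hτ] at this ⊢
        omega
      have h8' : (Nat.log 2 (r k) : ℝ) + 1 ≤ 10 * τ k := by exact_mod_cast h8
      rw [div_mul_eq_mul_div, le_div_iff₀ hb]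
      linarith
  refine ⟨η, t, d, hη0', hη2, by linarith, ht, hd, ⟨?_, ?_⟩, ?_, htτ, ⟨1 / 20, by norm_num, ?_⟩, ?_⟩
  · refine IsBigO.of_bound 2 ?_
    filter_upwards [hlogt] with k h
    rw [Real.norm_of_nonneg (Nat.cast_nonneg _), Real.norm_of_nonneg h.1]
    exact h.2.1
  · refine IsBigO.of_bound (10 / b) ?_
    filter_upwards [hlogt] with k h
    rw [Real.norm_of_nonneg (Nat.cast_nonneg _), Real.norm_of_nonneg h.1]
    exact h.2.2
  · refine IsBigO.of_bound (10 / b * 2 * 40) ?_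
    filter_upwards [hlogt, htτ, hdD, hDpos, hτ80, hτn] with k h h1 h2 h3 h4 h5
    rw [Real.norm_of_nonneg (Nat.cast_nonneg _), Real.norm_of_nonneg (sq_nonneg _), h2]
    have h6 : (τ k : ℝ) * Nat.log 2 (n k) ≤ 40 * D k := by exact_mod_cast h3.2
    have h7 := log_le_natLog_add_one (n k)
    have h8 : (1 : ℝ) ≤ Nat.log 2 (n k) := by exact_mod_cast (by omega : 1 ≤ Nat.log 2 (n k))
    have h9 := h.2.2
    rw [h1] at h9
    calc Real.log (n k) ^ 2 = Real.log (n k) * Real.log (n k) := sq _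
      _ ≤ (10 / b * τ k) * (2 * Nat.log 2 (n k)) :=
        mul_le_mul h9 (by linarith) h.1 (by positivity)
      _ = 10 / b * 2 * (τ k * Nat.log 2 (n k)) := by ring
      _ ≤ 10 / b * 2 * (40 * D k) := by gcongr
      _ = _ := by ring
  · filter_upwards [htτ, hdD] with k h1 h2
    rw [h1, h2]
  · intro A
    set κ' := max κ 0 with hκ'
    have hκ1 : κ' < 1 := max_lt hκ one_pos
    obtain ⟨l, b₀, hl0, hb₀0, hb₀1, hlb⟩ := exists_bias_threshold
      (Real.one_lt_rpow (by norm_num : (1 : ℝ) < 2) (by linarith : 0 < (1 - κ') / 2))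
    obtain ⟨T, hT⟩ := eventually_atTop.mp
      ((tendsto_pow_atTop_nhds_zero_of_lt_one hb₀0 hb₀1).eventually_le_const
        (by norm_num : (0 : ℝ) < 1 / 8))
    set s := min (3 / 5 * b) (1 / 2) with hs
    have hs0 : 0 < s := by positivity
    -- The failure bound `16 exp (-n ^ s)` becomes `16 exp (-k ^ (a s))` through `n ≥ k ^ a`.
    have hdecay := (superpolynomialDecay_exp_neg_rpow (mul_pos ha hs0)).const_mul 16
    refine hdecay.trans_eventually_abs_le ?_
    filter_upwards [htτ, hdD, hrb, hrκ, hrn, hna,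
      hn_top.eventually (eventually_reliable hb hγ0 hγ4),
      hn_top.eventually (eventually_failure_le (b := b) hκ1 hlb),
      hn_top.eventually (eventually_le_sparsity hb (T + 2)),
      hn_top.eventually eventually_natLog_sq_le,
      hn_top.eventually (eventually_const_mul_rpow_le (16 * 4)
        (by norm_num : (1 / 100 : ℝ) < 3 / 5)),
      hn_top.eventually_ge_atTop 1]
      with k h1 h2 h3 h4 h5 h6 hrel hfail hsp hL hpow hn1
    have hn1' : (1 : ℝ) ≤ n k := by exact_mod_cast hn1
    have hn0 : (0 : ℝ) < n k := by linarith
    have hrel := hrel (r k) (t k) (d k) h3 h5 h1 (by rw [h1, h2])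
    have hκn : (r k : ℝ) ≤ κ' * n k := h4.trans (by gcongr; exact le_max_left _ _)
    have hfail := hfail (r k) (t k) (d k) h3 h5 hκn h1 (by rw [h1, h2])
    have hb₀t := hT (t k - 2) (by have := (hsp (r k) (t k) h3 h1).2; omega)
    have htL : t k ≤ Nat.log 2 (n k) := by
      have := Nat.log_mono_right (b := 2) h5
      rw [h1]
      simp only [hτ]
      omega
    have hμ : 16 * (t k : ℝ) ^ 2 ≤ n k * (((n k : ℝ) ^ (-(1 / 10) : ℝ)) ^ 2 / 2) ^ 2 := by
      have e : (n k : ℝ) * (((n k : ℝ) ^ (-(1 / 10) : ℝ)) ^ 2) ^ 2 = (n k : ℝ) ^ (3 / 5 : ℝ) := by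
        rw [← pow_mul, ← Real.rpow_natCast, ← Real.rpow_mul hn0.le]
        nth_rw 1 [← Real.rpow_one (n k : ℝ)]
        rw [← Real.rpow_add hn0]; norm_num
      have e2 : (n k : ℝ) * (((n k : ℝ) ^ (-(1 / 10) : ℝ)) ^ 2 / 2) ^ 2
          = (n k : ℝ) ^ (3 / 5 : ℝ) / 4 := by
        rw [← e]; ring
      have htL2 : (t k : ℝ) ^ 2 ≤ (Nat.log 2 (n k) : ℝ) ^ 2 := by gcongr
      rw [e2]
      linarith
    have hwin := (hrel.winProb_le (η := η) (δ := δ) (hd k) (ht k)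
      (floor_mul_le_of_le_one (by linarith) (n k)) hη0.le hβ h5 hμ hb₀t hl0 (A k)).trans hfail
    refine (abs_of_nonneg ENNReal.toReal_nonneg).le.trans (hwin.trans ((le_abs_self _).trans' ?_))
    refine mul_le_mul_of_nonneg_left (Real.exp_le_exp.mpr (neg_le_neg ?_)) (by norm_num)
    rw [Real.rpow_mul (Nat.cast_nonneg k)]
    gcongr
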